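/- Let $\mathit{Sym}$ be the graded Hopf algebra of symmetric functions over $\mathbb{Q}$, with basis the monomial symmetric functions $m_\lambda$ ($\lambda$ a partition), the usual product of power series, and coproduct $\Delta(m_\lambda)=\sum_{\mu\sqcup\nu=\lambda}m_\mu\otimes m_\nu$ (the sum over ordered pairs of partitions whose union as multisets of parts is $\lambda$). Let $S$ be its antipode, and let $\zeta_S:\mathit{Sym}\to\mathbb{Q}$ be the character that sets one variable equal to $1$ and all the others to $0$. Put $\overline{\zeta_S}(h)=(-1)^n\zeta_S(h)$ for $h$ of degree $n$, and $\zeta_S^{-1}=\zeta_S\circ S$. The even subalgebra $S_+(\mathit{Sym},\zeta_S)$ is the largest graded subcoalgebra of $\mathit{Sym}$ on which $\overline{\zeta_S}=\zeta_S$; the odd subalgebra $S_-(\mathit{Sym},\zeta_S)$ is the largest graded subcoalgebra on which $\overline{\zeta_S}=\zeta_S^{-1}$. A composition or partition is called even (odd) if all its parts are even (odd). Let $p_n=m_{(n)}$ and $p_\lambda=p_{l_1}\cdots p_{l_k}$ for $\lambda=(l_1,\ldots,l_k)$. For a composition $\alpha=(a_1,\ldots,a_k)$ let $M_\alpha=\sum_{i_1<\cdots<i_k}x_{i_1}^{a_1}\cdots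 x_{i_k}^{a_k}$ and $k(\alpha)=k$; for an odd composition $\beta$ let $\eta_\beta=\sum_{\alpha\le\beta}2^{k(\alpha)}M_\alpha$, the sum over all compositions $\alpha$ of which $\beta$ is a refinement; and for an odd partition $\lambda$ let $\eta_\lambda=\sum_\alpha\eta_\alpha$, the sum over all distinct rearrangements $\alpha$ of $\lambda$. Let $q_n=\sum_{i=0}^n e_ih_{n-i}$, where $e_i$ and $h_i$ are the elementary and the complete homogeneous symmetric functions. Then: (a) $\{p_\lambda\}_{\lambda\text{ odd}}$ and $\{\eta_\lambda\}_{\lambda\text{ odd}}$ are both linear bases of $S_-(\mathit{Sym},\zeta_S)$, and $S_-(\mathit{Sym},\zeta_S)$ is the algebra of Schur $Q$-functions over $\mathbb{Q}$, i.e. the subalgebra of $\mathit{Sym}$ generated by the $q_n$, $n\ge1$. (b) $\{p_\lambda\}_{\lambda\text{ even}}$ and $\{m_\lambda\}_{\lambda\text{ even}}$ are both linear bases of $S_+(\mathit{Sym},\zeta_S)$. -/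

import Mathlib

open scoped TensorProduct

noncomputable section

namespace CombHopf

/-! ### Even and odd subalgebras of a graded Hopf algebra with a character -/

section General

variable {k H : Type*} [Field k] [Ring H] [HopfAlgebra k H]

/-- The canonical involution of a graded space: it is multiplication by `(-1)^n` on the
component of degree `n`. -/
def barInvolution (𝒜 : ℕ → Submodule k H) [DirectSum.Decomposition 𝒜] : H →ₗ[k] H :=
  DirectSum.toModule k ℕ H (fun n => ((-1 : k) ^ n) • (𝒜 n).subtype) ∘ₗ
    (DirectSum.decomposeLinearEquiv 𝒜).toLinearMap

/-- The functional `φ̄`, with `φ̄ h = (-1)^n φ h` for `h` of degree `n`. -/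
def barFunctional (𝒜 : ℕ → Submodule k H) [DirectSum.Decomposition 𝒜] (φ : H →ₗ[k] k) :
    H →ₗ[k] k :=
  φ ∘ₗ barInvolution 𝒜

/-- The convolution inverse `ζ⁻¹ = ζ ∘ S` of a character `ζ`, where `S` is the antipode. -/
def convInverse (ζ : H →ₐ[k] k) : H →ₗ[k] k :=
  ζ.toLinearMap ∘ₗ HopfAlgebra.antipode k

/-- `C` is a graded subcoalgebra: it contains the homogeneous components of its elements, and
`Δ(C) ⊆ C ⊗ C` inside `H ⊗ H`. -/
structure IsGradedSubcoalgebra (𝒜 : ℕ → Submodule k H) [DirectSum.Decomposition 𝒜]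
    (C : Submodule k H) : Prop where
  homogeneous : ∀ h ∈ C, ∀ n : ℕ, (DirectSum.decompose 𝒜 h n : H) ∈ C
  comul_mem : ∀ h ∈ C, (Coalgebra.comul (R := k) h : H ⊗[k] H) ∈
    LinearMap.range (TensorProduct.map C.subtype C.subtype)

/-- `S(φ, ψ)`: the largest graded subcoalgebra on which the functionals `φ` and `ψ` agree
(see `isGreatest_agreeSub`). -/
def agreeSub (𝒜 : ℕ → Submodule k H) [DirectSum.Decomposition 𝒜] (φ ψ : H →ₗ[k] k) :
    Submodule k H :=
  sSup {C | IsGradedSubcoalgebra 𝒜 C ∧ ∀ h ∈ C, φ h = ψ h}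

theorem isGreatest_agreeSub (𝒜 : ℕ → Submodule k H) [DirectSum.Decomposition 𝒜]
    (φ ψ : H →ₗ[k] k) :
    IsGreatest {C | IsGradedSubcoalgebra 𝒜 C ∧ ∀ h ∈ C, φ h = ψ h} (agreeSub 𝒜 φ ψ) := by
  refine ⟨⟨⟨?_, ?_⟩, ?_⟩, fun C hC => le_sSup hC⟩
  · intro h hh n
    have key : agreeSub 𝒜 φ ψ ≤ (agreeSub 𝒜 φ ψ).comap
        ((𝒜 n).subtype ∘ₗ DirectSum.component k ℕ (fun i => 𝒜 i) n ∘ₗ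
          (DirectSum.decomposeLinearEquiv 𝒜).toLinearMap) := by
      refine sSup_le fun C hC x hx => ?_
      exact (le_sSup hC : C ≤ agreeSub 𝒜 φ ψ) (hC.1.homogeneous x hx n)
    exact key hh
  · intro h hh
    have key : agreeSub 𝒜 φ ψ ≤ (LinearMap.range (TensorProduct.map (agreeSub 𝒜 φ ψ).subtype
        (agreeSub 𝒜 φ ψ).subtype)).comap (Coalgebra.comul (R := k) (A := H)) := by
      refine sSup_le fun C hC x hx => ?_
      have hle : C ≤ agreeSub 𝒜 φ ψ := le_sSup hC
      obtain ⟨y, hy⟩ := hC.1.comul_mem x hx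
      refine ⟨TensorProduct.map (Submodule.inclusion hle) (Submodule.inclusion hle) y, ?_⟩
      rw [← hy, ← LinearMap.comp_apply, ← TensorProduct.map_comp]
      rfl
    exact key hh
  · intro h hh
    have key : agreeSub 𝒜 φ ψ ≤ LinearMap.ker (φ - ψ) := by
      refine sSup_le fun C hC x hx => ?_
      simp [hC.2 x hx]
    have := key hh
    simpa [sub_eq_zero] using this

/-- The even subalgebra `S₊(H, ζ) = S(ζ̄, ζ)`. -/
def evenSubalgebra (𝒜 : ℕ → Submodule k H) [DirectSum.Decomposition 𝒜] (ζ : H →ₐ[k] k) :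
    Submodule k H :=
  agreeSub 𝒜 (barFunctional 𝒜 ζ.toLinearMap) ζ.toLinearMap

/-- The odd subalgebra `S₋(H, ζ) = S(ζ̄, ζ⁻¹)`. -/
def oddSubalgebra (𝒜 : ℕ → Submodule k H) [DirectSum.Decomposition 𝒜] (ζ : H →ₐ[k] k) :
    Submodule k H :=
  agreeSub 𝒜 (barFunctional 𝒜 ζ.toLinearMap) (convInverse ζ)

end General

/-! ### Compositions, partitions and monomial functions -/

/-- A composition is a finite list of positive integers (the empty list is the composition
of `0`). -/
abbrev IntComp : Type := List ℕ+

/-- A partition is a finite multiset of positive integers (the parts).  Rearranging the parts of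
a composition `α` gives the partition `(α : Multiset ℕ+)`. -/
abbrev IntPart : Type := Multiset ℕ+

/-- The sum `|α|` of the parts of a composition. -/
def IntComp.size (α : IntComp) : ℕ := (α.map (fun n : ℕ+ => (n : ℕ))).sum

/-- The set `I(α) = {a₁, a₁ + a₂, …, a₁ + ⋯ + a_{k-1}}` of proper partial sums. -/
def IntComp.partialSums (α : IntComp) : Finset ℕ :=
  (Finset.Ico 1 α.length).image fun i => IntComp.size (α.take i)

theorem IntComp.finite_size (n : ℕ) : {α : IntComp | IntComp.size α = n}.Finite := by
  refine (Set.finite_range fun c : Composition n => (c.blocks.map Nat.toPNat' : IntComp)).subset ?_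
  rintro α rfl
  refine ⟨⟨α.map (fun n : ℕ+ => (n : ℕ)), ?_, rfl⟩, ?_⟩
  · intro i hi
    obtain ⟨a, -, rfl⟩ := List.mem_map.1 hi
    exact a.pos
  · simp [List.map_map, Function.comp_def]

theorem IntComp.finite_coarsenings (β : IntComp) :
    {α : IntComp | IntComp.size α = IntComp.size β ∧ IntComp.partialSums α ⊆ IntComp.partialSums β}.Finite :=
  (IntComp.finite_size (IntComp.size β)).subset fun _ h => h.1

/-- The finite set of compositions `α ≤ β`, i.e. of those `α` of the same size such that `β`
refines `α`. -/
def IntComp.coarsenings (β : IntComp) : Finset IntComp := (IntComp.finite_coarsenings β).toFinset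

/-- A partition is odd if all its parts are odd. -/
def IntPart.IsOdd (l : IntPart) : Prop := ∀ n ∈ l, Odd (n : ℕ)

/-- A partition is even if all its parts are even. -/
def IntPart.IsEven (l : IntPart) : Prop := ∀ n ∈ l, Even (n : ℕ)

/-- The nonzero exponents of the monomial `x ^ a`, in increasing order of the variables. -/
def exponents (a : ℕ →₀ ℕ) : List ℕ := (a.support.sort (· ≤ ·)).map a

/-- The monomial quasi-symmetric function
`M_α = ∑_{i₁ < ⋯ < i_k} x_{i₁}^{a₁} ⋯ x_{i_k}^{a_k}`, a power series in `x₀, x₁, …`. -/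
def monoQSym (α : IntComp) : MvPowerSeries ℕ ℚ := fun a =>
  if exponents a = α.map (fun n : ℕ+ => (n : ℕ)) then 1 else 0

/-- The monomial symmetric function `m_λ`: the sum of `M_α` over the distinct rearrangements `α`
of `λ`. -/
def monoSymSeries (l : IntPart) : MvPowerSeries ℕ ℚ := ∑ α ∈ l.lists.toFinset, monoQSym α

/-- `η_β = ∑_{α ≤ β} 2^{k(α)} M_α`, where `k(α)` is the number of parts of `α`. -/
def etaComp (β : IntComp) : MvPowerSeries ℕ ℚ :=
  ∑ α ∈ IntComp.coarsenings β, (2 : ℚ) ^ α.length • monoQSym α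

/-- `η_λ`: the sum of `η_α` over the distinct rearrangements `α` of `λ`. -/
def etaPart (l : IntPart) : MvPowerSeries ℕ ℚ := ∑ α ∈ l.lists.toFinset, etaComp α

/-! ### The algebra of symmetric functions -/

/-- The multiset of nonzero exponents of the monomial `x ^ a`. -/
def shape (a : ℕ →₀ ℕ) : Multiset ℕ := a.support.val.map a

/-- The multiset of the parts of a partition, as natural numbers. -/
def IntPart.parts (l : IntPart) : Multiset ℕ := l.map (fun n : ℕ+ => (n : ℕ))

theorem IntPart.parts_injective : Function.Injective IntPart.parts :=
  Multiset.map_injective PNat.coe_injective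

theorem shape_eq (a : ℕ →₀ ℕ) : shape a = (exponents a : Multiset ℕ) := by
  rw [shape, exponents, ← Multiset.map_coe, Finset.sort_eq]

theorem exists_part (a : ℕ →₀ ℕ) : ∃ l : IntPart, l.parts = shape a := by
  refine ⟨(shape a).map Nat.toPNat', ?_⟩
  rw [IntPart.parts, Multiset.map_map]
  conv_rhs => rw [← Multiset.map_id (shape a)]
  refine Multiset.map_congr rfl fun n hn => ?_
  obtain ⟨i, hi, rfl⟩ := Multiset.mem_map.1 hn
  have : 0 < a i := Nat.pos_of_ne_zero (by simpa using hi)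
  simp [this]

theorem coeff_monoSymSeries (l : IntPart) (a : ℕ →₀ ℕ) :
    MvPowerSeries.coeff a (monoSymSeries l) = if shape a = l.parts then 1 else 0 := by
  have h1 : ∀ α : IntComp, MvPowerSeries.coeff a (monoQSym α) =
      if exponents a = α.map (fun n : ℕ+ => (n : ℕ)) then 1 else 0 := fun α => rfl
  rw [monoSymSeries, map_sum]
  simp only [h1]
  split_ifs with h
  · have : ∃ α : IntComp, α ∈ l.lists.toFinset ∧
        exponents a = α.map (fun n : ℕ+ => (n : ℕ)) := by
      induction l using Quotient.inductionOn with
      | h L =>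
      have hp : (exponents a).Perm (L.map (fun n : ℕ+ => (n : ℕ))) := by
        rw [shape_eq] at h
        exact Multiset.coe_eq_coe.1 h
      have : ∀ e : List ℕ, e.Perm (L.map (fun n : ℕ+ => (n : ℕ))) →
          ∃ α : IntComp, α.Perm L ∧ e = α.map (fun n : ℕ+ => (n : ℕ)) := by
        intro e he
        have hpos : ∀ x ∈ e, 0 < x := by
          intro x hx
          obtain ⟨y, -, rfl⟩ := List.mem_map.1 (he.mem_iff.1 hx)
          exact y.pos
        refine ⟨e.map Nat.toPNat', ?_, ?_⟩
        · have := he.map Nat.toPNat'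
          simpa [List.map_map, Function.comp_def] using this
        · rw [List.map_map]
          conv_lhs => rw [← List.map_id e]
          refine List.map_congr_left fun x hx => ?_
          simp [hpos x hx]
      obtain ⟨α, h1, h2⟩ := this _ hp
      refine ⟨α, ?_, h2⟩
      rw [Multiset.mem_toFinset]
      exact (Multiset.mem_lists_iff (L : Multiset ℕ+) α).2 (Quotient.sound h1).symm
    obtain ⟨α, hα, he⟩ := this
    rw [Finset.sum_eq_single_of_mem α hα, if_pos he]
    intro β _ hne
    rw [if_neg]
    intro hb
    exact hne (List.map_injective_iff.2 PNat.coe_injective (hb.symm.trans he))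
  · refine Finset.sum_eq_zero fun α hα => if_neg fun he => h ?_
    rw [Multiset.mem_toFinset, Multiset.mem_lists_iff] at hα
    rw [shape_eq, he, hα]
    rfl

theorem exists_perm {a b : ℕ →₀ ℕ} (h : shape a = shape b) :
    ∃ e : ℕ ≃ ℕ, ∀ i, b (e i) = a i := by
  have hf : ∀ c : ℕ, Nonempty ({i // a i = c} ≃ {i // b i = c}) := by
    intro c
    rcases Nat.eq_zero_or_pos c with rfl | hc
    · have inf : ∀ f : ℕ →₀ ℕ, Infinite {i // f i = 0} := by
        intro f
        have : ({i | f i = 0} : Set ℕ) = (f.support : Set ℕ)ᶜ := by ext; simp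
        have h2 : ({i | f i = 0} : Set ℕ).Infinite := by
          rw [this]; exact f.support.finite_toSet.infinite_compl
        exact h2.to_subtype
      have := inf a
      have := inf b
      exact nonempty_equiv_of_countable
    · have cnt : ∀ f : ℕ →₀ ℕ, ∃ s : Finset ℕ, (∀ i, i ∈ s ↔ f i = c) ∧
          s.card = (shape f).count c := by
        intro f
        refine ⟨f.support.filter (fun i => c = f i), ?_, ?_⟩
        · intro i
          simp only [Finset.mem_filter, Finsupp.mem_support_iff]
          constructor
          · rintro ⟨-, h⟩; exact h.symm
          · rintro rfl; exact ⟨hc.ne', rfl⟩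
        · rw [shape, Multiset.count_map]; rfl
      obtain ⟨s, hs, hsc⟩ := cnt a
      obtain ⟨t, ht, htc⟩ := cnt b
      have : s.card = t.card := by rw [hsc, htc, h]
      refine ⟨(Equiv.subtypeEquivRight fun i => (hs i).symm).trans
        ((Finset.equivOfCardEq this).trans (Equiv.subtypeEquivRight ht))⟩
  have e : ∀ c : ℕ, {i // a i = c} ≃ {i // b i = c} := fun c => (hf c).some
  exact ⟨Equiv.ofFiberEquiv (f := a) (g := b) e, fun i => Equiv.ofFiberEquiv_map e i⟩

/-- Symmetric power series of bounded degree. -/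
def IsSymmetricSeries (f : MvPowerSeries ℕ ℚ) : Prop :=
  (∃ N : ℕ, ∀ a : ℕ →₀ ℕ, N < a.degree → MvPowerSeries.coeff a f = 0) ∧
    ∀ a b : ℕ →₀ ℕ, shape a = shape b → MvPowerSeries.coeff a f = MvPowerSeries.coeff b f

theorem sum_shape (a : ℕ →₀ ℕ) : (shape a).sum = a.degree := rfl

theorem exists_shape (l : IntPart) : ∃ a : ℕ →₀ ℕ, shape a = l.parts := by
  induction l using Multiset.induction_on with
  | empty => exact ⟨0, by simp [shape, IntPart.parts]⟩
  | cons n l ih =>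
    obtain ⟨a, ha⟩ := ih
    obtain ⟨i, hi⟩ := Infinite.exists_notMem_finset a.support
    have hdis : Disjoint a.support (Finsupp.single i (n : ℕ)).support := by
      rw [Finsupp.support_single _ n.ne_zero]
      simpa using hi
    refine ⟨a + Finsupp.single i (n : ℕ), ?_⟩
    have hi0 : a i = 0 := by simpa using hi
    rw [shape, Finsupp.support_add_eq hdis, Finsupp.support_single _ n.ne_zero,
      Finset.union_comm]
    have : ({i} ∪ a.support).val = i ::ₘ a.support.val := by
      rw [← Finset.insert_eq, Finset.insert_val_of_notMem hi]
    rw [this, Multiset.map_cons]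
    simp only [IntPart.parts, Multiset.map_cons] at ha ⊢
    rw [← ha, shape]
    congr 1
    · simp [hi0]
    · refine Multiset.map_congr rfl fun j hj => ?_
      have : i ≠ j := by rintro rfl; exact hi hj
      simp [this]

theorem isSymmetricSeries_mono (l : IntPart) : IsSymmetricSeries (monoSymSeries l) := by
  refine ⟨⟨l.parts.sum, fun a ha => ?_⟩, fun a b h => ?_⟩
  · rw [coeff_monoSymSeries, if_neg]
    intro h
    rw [← sum_shape, h] at ha
    exact lt_irrefl _ ha
  · rw [coeff_monoSymSeries, coeff_monoSymSeries, h]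

theorem mem_span_iff (f : MvPowerSeries ℕ ℚ) :
    f ∈ Submodule.span ℚ (Set.range monoSymSeries) ↔ IsSymmetricSeries f := by
  constructor
  · intro hf
    induction hf using Submodule.span_induction with
    | mem x hx => obtain ⟨l, rfl⟩ := hx; exact isSymmetricSeries_mono l
    | zero => exact ⟨⟨0, by simp⟩, by simp⟩
    | add x y _ _ hx hy =>
      obtain ⟨⟨N, hN⟩, hx⟩ := hx
      obtain ⟨⟨N', hN'⟩, hy⟩ := hy
      refine ⟨⟨max N N', fun a ha => ?_⟩, fun a b h => ?_⟩
      · rw [map_add, hN a (by omega), hN' a (by omega), add_zero]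
      · rw [map_add, map_add, hx a b h, hy a b h]
    | smul c x _ hx =>
      obtain ⟨⟨N, hN⟩, hx⟩ := hx
      refine ⟨⟨N, fun a ha => ?_⟩, fun a b h => ?_⟩
      · rw [map_smul, hN a ha, smul_zero]
      · rw [map_smul, map_smul, hx a b h]
  · rintro ⟨⟨N, hN⟩, hf⟩
    choose rep hrep using exists_shape
    have hfin : {l : IntPart | l.parts.sum ≤ N}.Finite := by
      have h1 : {α : IntComp | IntComp.size α ≤ N}.Finite := by
        have : {α : IntComp | IntComp.size α ≤ N} =
            ⋃ n ∈ Set.Iic N, {α : IntComp | IntComp.size α = n} := by ext; simp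
        rw [this]
        exact (Set.finite_Iic N).biUnion fun n _ => IntComp.finite_size n
      refine (h1.image (fun α : IntComp => ((α : Multiset ℕ+) : IntPart))).subset ?_
      intro l hl
      induction l using Quotient.inductionOn with
      | h L => exact ⟨L, by simpa [IntPart.parts, IntComp.size] using hl, rfl⟩
    have : f = ∑ l ∈ hfin.toFinset, MvPowerSeries.coeff (rep l) f • monoSymSeries l := by
      ext a
      rw [map_sum]
      simp only [map_smul, coeff_monoSymSeries, smul_eq_mul]
      obtain ⟨l, hl⟩ := exists_part a
      by_cases ha : N < a.degree
      · rw [hN a ha, Finset.sum_eq_zero]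
        intro l' hl'
        rw [if_neg, mul_zero]
        intro h
        have := hfin.mem_toFinset.1 hl'
        simp only [Set.mem_ofPred_eq, ← h, sum_shape] at this
        omega
      · rw [Finset.sum_eq_single_of_mem l, if_pos hl.symm, mul_one]
        · exact hf _ _ (by rw [hrep, hl])
        · rw [hfin.mem_toFinset, Set.mem_ofPred_eq, hl, sum_shape]; omega
        · intro l' _ hne
          rw [if_neg, mul_zero]
          intro h
          exact hne (IntPart.parts_injective (h.symm.trans hl.symm))
    rw [this]
    exact Submodule.sum_mem _ fun l _ => Submodule.smul_mem _ _
      (Submodule.subset_span ⟨l, rfl⟩)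

theorem coeff_renameEquiv (e : ℕ ≃ ℕ) (f : MvPowerSeries ℕ ℚ) (a : ℕ →₀ ℕ) :
    MvPowerSeries.coeff (a.embDomain e.toEmbedding) (MvPowerSeries.renameEquiv ℚ e f) =
      MvPowerSeries.coeff a f :=
  MvPowerSeries.coeff_embDomain_rename e.toEmbedding f a

theorem shape_embDomain (e : ℕ ↪ ℕ) (a : ℕ →₀ ℕ) : shape (a.embDomain e) = shape a := by
  simp [shape, Finsupp.support_embDomain, Finset.map_val, Multiset.map_map]

theorem IsSymmetricSeries.mul {f g : MvPowerSeries ℕ ℚ} (hf : IsSymmetricSeries f)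
    (hg : IsSymmetricSeries g) : IsSymmetricSeries (f * g) := by
  have inv : ∀ {f : MvPowerSeries ℕ ℚ}, IsSymmetricSeries f → ∀ e : ℕ ≃ ℕ,
      MvPowerSeries.renameEquiv ℚ e f = f := by
    intro f hf e
    ext a
    have ha : a = (a.embDomain e.symm.toEmbedding).embDomain e.toEmbedding := by
      ext i
      obtain ⟨j, rfl⟩ := e.surjective i
      rw [show e j = e.toEmbedding j from rfl, Finsupp.embDomain_apply_self]
      conv_rhs => rw [← e.symm_apply_apply j]
      exact (Finsupp.embDomain_apply_self e.symm.toEmbedding a (e j)).symm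
    conv_lhs => rw [ha]
    rw [coeff_renameEquiv]
    exact hf.2 _ _ (shape_embDomain _ _)
  obtain ⟨⟨N, hN⟩, -⟩ := id hf
  obtain ⟨⟨N', hN'⟩, -⟩ := id hg
  refine ⟨⟨N + N', fun a ha => ?_⟩, fun a b h => ?_⟩
  · rw [MvPowerSeries.coeff_mul]
    refine Finset.sum_eq_zero fun p hp => ?_
    rw [Finset.HasAntidiagonal.mem_antidiagonal] at hp
    rw [← hp, map_add] at ha
    by_cases h1 : N < p.1.degree
    · rw [hN _ h1, zero_mul]
    · rw [hN' _ (by omega), mul_zero]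
  · obtain ⟨e, he⟩ := exists_perm h
    have hb : b = a.embDomain e.toEmbedding := by
      ext i
      obtain ⟨j, rfl⟩ := e.surjective i
      rw [he]
      exact (Finsupp.embDomain_apply_self e.toEmbedding a j).symm
    have : MvPowerSeries.renameEquiv ℚ e (f * g) = f * g := by rw [map_mul, inv hf, inv hg]
    rw [hb]
    conv_rhs => rw [← this]
    rw [coeff_renameEquiv]

theorem monoSymSeries_zero : monoSymSeries 0 = 1 := by
  ext a
  rw [coeff_monoSymSeries, MvPowerSeries.coeff_one]
  simp [shape, IntPart.parts]

/-- The algebra `Sym` of symmetric functions over `ℚ`: the span of the `m_λ`, a subalgebra of the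
algebra of formal power series. -/
def Sym : Subalgebra ℚ (MvPowerSeries ℕ ℚ) :=
  (Submodule.span ℚ (Set.range monoSymSeries)).toSubalgebra
    (by rw [← monoSymSeries_zero]; exact Submodule.subset_span ⟨0, rfl⟩)
    (fun f g hf hg => by
      rw [mem_span_iff] at *
      exact hf.mul hg)

theorem mem_Sym_iff (f : MvPowerSeries ℕ ℚ) : f ∈ Sym ↔ IsSymmetricSeries f :=
  mem_span_iff f

/-- The coefficient of the monomial `x ^ a` in a symmetric function. -/
def symCoeff (a : ℕ →₀ ℕ) : Sym →ₗ[ℚ] ℚ := MvPowerSeries.coeff a ∘ₗ Sym.val.toLinearMap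

theorem Sym_ext {f g : Sym} (h : ∀ a, symCoeff a f = symCoeff a g) : f = g :=
  Subtype.ext (MvPowerSeries.ext h)

/-- `m_λ` as an element of `Sym`. -/
def monoSym (l : IntPart) : Sym := ⟨monoSymSeries l, Submodule.subset_span ⟨l, rfl⟩⟩

theorem symCoeff_monoSym (a : ℕ →₀ ℕ) (l : IntPart) :
    symCoeff a (monoSym l) = if shape a = l.parts then 1 else 0 :=
  coeff_monoSymSeries l a

/-- The basis `(m_λ)` of `Sym`. -/
def monoBasis : Module.Basis IntPart ℚ Sym :=
  Module.Basis.mk (v := monoSym)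
    (by
      rw [linearIndependent_iff']
      intro s c hc l hl
      obtain ⟨a, ha⟩ := exists_shape l
      have := congrArg (symCoeff a) hc
      rw [map_sum, map_zero] at this
      simp only [map_smul, symCoeff_monoSym, ha, smul_eq_mul] at this
      rw [Finset.sum_eq_single_of_mem l hl] at this
      · simpa using this
      · intro b _ hne
        rw [if_neg fun h => hne (IntPart.parts_injective h.symm), mul_zero])
    (by
      rintro ⟨f, hf⟩ -
      have hf' : f ∈ Submodule.span ℚ (Set.range monoSymSeries) := hf
      have h1 : Set.range monoSymSeries = Sym.val.toLinearMap '' Set.range monoSym := by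
        rw [← Set.range_comp]; rfl
      rw [h1, ← Submodule.map_span] at hf'
      obtain ⟨g, hg, hgf⟩ := hf'
      have : g = ⟨f, hf⟩ := Subtype.ext hgf
      rwa [← this])

theorem monoBasis_apply (l : IntPart) : monoBasis l = monoSym l := by
  simp [monoBasis]

/-! ### The Hopf algebra structure -/

/-- The finite set of ordered pairs of partitions `(μ, ν)` with `μ ⊔ ν = λ` as multisets. -/
def IntPart.splittings (l : IntPart) : Finset (IntPart × IntPart) := (Multiset.antidiagonal l).toFinset

theorem IntPart.mem_splittings {l : IntPart} {p : IntPart × IntPart} :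
    p ∈ l.splittings ↔ p.1 + p.2 = l := by
  rw [IntPart.splittings, Multiset.mem_toFinset]
  exact Multiset.mem_antidiagonal

/-- The coproduct `Δ(m_λ) = ∑_{μ ⊔ ν = λ} m_μ ⊗ m_ν` of `Sym`.  It is the restriction of the
deconcatenation coproduct `Δ(M_α) = ∑_{α = βγ} M_β ⊗ M_γ` of quasi-symmetric functions. -/
def symComul : Sym →ₗ[ℚ] Sym ⊗[ℚ] Sym :=
  monoBasis.constr ℚ fun l => ∑ p ∈ l.splittings, monoSym p.1 ⊗ₜ[ℚ] monoSym p.2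

/-- The counit of `Sym`, the constant coefficient. -/
def symCounit : Sym →ₗ[ℚ] ℚ := symCoeff 0

theorem symComul_mono (l : IntPart) : symComul (monoSym l) =
    ∑ p ∈ l.splittings, monoSym p.1 ⊗ₜ[ℚ] monoSym p.2 := by
  rw [← monoBasis_apply, symComul, Module.Basis.constr_basis]

theorem symCounit_mono (l : IntPart) : symCounit (monoSym l) = if l = 0 then 1 else 0 := by
  rw [symCounit, symCoeff_monoSym]
  have : shape 0 = IntPart.parts 0 := by simp [shape, IntPart.parts]
  rw [this]
  simp only [IntPart.parts_injective.eq_iff, eq_comm]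

instance : Coalgebra ℚ Sym where
  comul := symComul
  counit := symCounit
  coassoc := by
    refine monoBasis.ext fun l => ?_
    simp only [monoBasis_apply, LinearMap.comp_apply, symComul_mono, map_sum,
      LinearMap.rTensor_tmul, LinearMap.lTensor_tmul, TensorProduct.sum_tmul,
      TensorProduct.tmul_sum, LinearEquiv.coe_coe, TensorProduct.assoc_tmul]
    rw [Finset.sum_sigma', Finset.sum_sigma']
    refine Finset.sum_bij' (fun x _ => ⟨(x.2.1, x.2.2 + x.1.2), (x.2.2, x.1.2)⟩)
      (fun x _ => ⟨(x.1.1 + x.2.1, x.2.2), (x.1.1, x.2.1)⟩) ?_ ?_ ?_ ?_ ?_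
    · rintro ⟨⟨a, b⟩, ⟨c, d⟩⟩ h
      simp only [Finset.mem_sigma, IntPart.mem_splittings] at h ⊢
      obtain ⟨h1, h2⟩ := h
      exact ⟨by rw [← add_assoc, h2, h1], trivial⟩
    · rintro ⟨⟨a, b⟩, ⟨c, d⟩⟩ h
      simp only [Finset.mem_sigma, IntPart.mem_splittings] at h ⊢
      obtain ⟨h1, h2⟩ := h
      exact ⟨by rw [add_assoc, h2, h1], trivial⟩
    · rintro ⟨⟨a, b⟩, ⟨c, d⟩⟩ h
      simp only [Finset.mem_sigma, IntPart.mem_splittings] at h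
      simp [h.2]
    · rintro ⟨⟨a, b⟩, ⟨c, d⟩⟩ h
      simp only [Finset.mem_sigma, IntPart.mem_splittings] at h
      simp [h.2]
    · rintro ⟨⟨a, b⟩, ⟨c, d⟩⟩ h
      rfl
  rTensor_counit_comp_comul := by
    refine monoBasis.ext fun l => ?_
    simp only [monoBasis_apply, LinearMap.comp_apply, symComul_mono, map_sum,
      LinearMap.rTensor_tmul, symCounit_mono, TensorProduct.mk_apply]
    rw [Finset.sum_eq_single_of_mem (0, l) (by simp [IntPart.mem_splittings])]
    · simp
    · rintro ⟨a, b⟩ h hne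
      rw [IntPart.mem_splittings] at h
      rw [if_neg, TensorProduct.zero_tmul]
      rintro rfl
      simp only [zero_add] at h
      exact hne (by rw [h])
  lTensor_counit_comp_comul := by
    refine monoBasis.ext fun l => ?_
    simp only [monoBasis_apply, LinearMap.comp_apply, symComul_mono, map_sum,
      LinearMap.lTensor_tmul, symCounit_mono, LinearMap.flip_apply, TensorProduct.mk_apply]
    rw [Finset.sum_eq_single_of_mem (l, 0) (by simp [IntPart.mem_splittings])]
    · simp
    · rintro ⟨a, b⟩ h hne
      rw [IntPart.mem_splittings] at h
      rw [if_neg, TensorProduct.tmul_zero]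
      rintro rfl
      simp only [add_zero] at h
      exact hne (by rw [h])

theorem comul_monoSym (l : IntPart) : Coalgebra.comul (R := ℚ) (monoSym l) =
    ∑ p ∈ l.splittings, monoSym p.1 ⊗ₜ[ℚ] monoSym p.2 := symComul_mono l

theorem counit_monoSym (l : IntPart) :
    Coalgebra.counit (R := ℚ) (monoSym l) = if l = 0 then (1 : ℚ) else 0 := symCounit_mono l

/-- `f ⊗ g ↦ f(x) g(y)`, into power series in two sets of variables. -/
def twoAlphabets : Sym ⊗[ℚ] Sym →ₐ[ℚ] MvPowerSeries (ℕ ⊕ ℕ) ℚ :=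
  Algebra.TensorProduct.productMap
    ((MvPowerSeries.rename (Function.Embedding.inl : ℕ ↪ ℕ ⊕ ℕ)).comp Sym.val)
    ((MvPowerSeries.rename (Function.Embedding.inr : ℕ ↪ ℕ ⊕ ℕ)).comp Sym.val)

/-- The exponent `x ^ a y ^ b`. -/
def pairExp (a b : ℕ →₀ ℕ) : ℕ ⊕ ℕ →₀ ℕ :=
  a.embDomain Function.Embedding.inl + b.embDomain Function.Embedding.inr

theorem pairExp_inl (a b : ℕ →₀ ℕ) (i : ℕ) : pairExp a b (Sum.inl i) = a i := by
  have h1 : a.embDomain Function.Embedding.inl (Sum.inl i : ℕ ⊕ ℕ) = a i :=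
    Finsupp.embDomain_apply_self Function.Embedding.inl a i
  have h2 : b.embDomain Function.Embedding.inr (Sum.inl i : ℕ ⊕ ℕ) = 0 :=
    Finsupp.embDomain_of_notMem_range _ _ _ (by simp)
  rw [pairExp, Finsupp.add_apply, h1, h2]
  simp

theorem pairExp_inr (a b : ℕ →₀ ℕ) (i : ℕ) : pairExp a b (Sum.inr i) = b i := by
  have h1 : b.embDomain Function.Embedding.inr (Sum.inr i : ℕ ⊕ ℕ) = b i :=
    Finsupp.embDomain_apply_self Function.Embedding.inr b i
  have h2 : a.embDomain Function.Embedding.inl (Sum.inr i : ℕ ⊕ ℕ) = 0 :=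
    Finsupp.embDomain_of_notMem_range _ _ _ (by simp)
  rw [pairExp, Finsupp.add_apply, h1, h2]
  simp

theorem exists_pairExp (c : ℕ ⊕ ℕ →₀ ℕ) : ∃ a b, c = pairExp a b := by
  refine ⟨c.comapDomain Sum.inl (Sum.inl_injective.injOn),
    c.comapDomain Sum.inr (Sum.inr_injective.injOn), ?_⟩
  ext i
  rcases i with i | i
  · simp [pairExp_inl]
  · simp [pairExp_inr]

theorem pairExp_injective {a b a' b' : ℕ →₀ ℕ} (h : pairExp a b = pairExp a' b') :
    a = a' ∧ b = b' := by
  constructor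
  · ext i; rw [← pairExp_inl a b, h, pairExp_inl]
  · ext i; rw [← pairExp_inr a b, h, pairExp_inr]

theorem coeff_twoAlphabets (f g : Sym) (a b : ℕ →₀ ℕ) :
    MvPowerSeries.coeff (pairExp a b) (twoAlphabets (f ⊗ₜ[ℚ] g)) =
      symCoeff a f * symCoeff b g := by
  rw [twoAlphabets, Algebra.TensorProduct.productMap_apply_tmul, MvPowerSeries.coeff_mul]
  rw [Finset.sum_eq_single_of_mem (a.embDomain Function.Embedding.inl,
    b.embDomain Function.Embedding.inr)
    (Finset.HasAntidiagonal.mem_antidiagonal.2 (show _ = pairExp a b from rfl))]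
  · simp only [AlgHom.comp_apply, MvPowerSeries.coeff_embDomain_rename]
    rfl
  · rintro ⟨p, q⟩ hpq hne
    rw [Finset.HasAntidiagonal.mem_antidiagonal] at hpq
    simp only [AlgHom.comp_apply]
    by_cases hp : p ∈ Set.range (Finsupp.mapDomain (Function.Embedding.inl : ℕ ↪ ℕ ⊕ ℕ))
    · by_cases hq : q ∈ Set.range (Finsupp.mapDomain (Function.Embedding.inr : ℕ ↪ ℕ ⊕ ℕ))
      · exfalso
        obtain ⟨a', rfl⟩ := hp
        obtain ⟨b', rfl⟩ := hq
        rw [← Finsupp.embDomain_eq_mapDomain, ← Finsupp.embDomain_eq_mapDomain] at hpq hne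
        obtain ⟨rfl, rfl⟩ := pairExp_injective hpq
        exact hne rfl
      · rw [MvPowerSeries.coeff_rename_eq_zero _ _ hq, mul_zero]
    · rw [MvPowerSeries.coeff_rename_eq_zero _ _ hp, zero_mul]

theorem twoAlphabets_injective : Function.Injective twoAlphabets := by
  rw [injective_iff_map_eq_zero]
  intro x hx
  have key : ∀ (l l' : IntPart) (a b : ℕ →₀ ℕ), shape a = l.parts → shape b = l'.parts →
      ∀ x, MvPowerSeries.coeff (pairExp a b) (twoAlphabets x) =
        (monoBasis.tensorProduct monoBasis).repr x (l, l') := by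
    intro l l' a b ha hb x
    have : MvPowerSeries.coeff (pairExp a b) ∘ₗ twoAlphabets.toLinearMap =
        (Finsupp.lapply (l, l')) ∘ₗ
          (monoBasis.tensorProduct monoBasis).repr.toLinearMap := by
      refine (monoBasis.tensorProduct monoBasis).ext ?_
      rintro ⟨μ, ν⟩
      rw [LinearMap.comp_apply, LinearMap.comp_apply, LinearEquiv.coe_coe,
        Module.Basis.repr_self, Module.Basis.tensorProduct_apply]
      simp only [monoBasis_apply, AlgHom.toLinearMap_apply, coeff_twoAlphabets,
        symCoeff_monoSym, ha, hb, IntPart.parts_injective.eq_iff, Finsupp.lapply_apply,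
        Finsupp.single_apply, Prod.mk.injEq]
      by_cases h1 : l = μ <;> by_cases h2 : l' = ν <;> simp [h1, h2, eq_comm]
    exact LinearMap.congr_fun this x
  refine (monoBasis.tensorProduct monoBasis).repr.map_eq_zero_iff.1 ?_
  ext ⟨l, l'⟩
  obtain ⟨a, ha⟩ := exists_shape l
  obtain ⟨b, hb⟩ := exists_shape l'
  rw [← key l l' a b ha hb, hx]
  simp

theorem shape_pairExp (e : ℕ ≃ ℕ ⊕ ℕ) (a b : ℕ →₀ ℕ) :
    shape ((pairExp a b).embDomain e.symm.toEmbedding) = shape a + shape b := by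
  have h : (pairExp a b).support = a.support.map Function.Embedding.inl ∪
      b.support.map Function.Embedding.inr := by
    ext i
    rcases i with i | i <;> simp [pairExp_inl, pairExp_inr]
  have hd : Disjoint (a.support.map (Function.Embedding.inl : ℕ ↪ ℕ ⊕ ℕ))
      (b.support.map Function.Embedding.inr) := by
    rw [Finset.disjoint_left]
    rintro (i | i) <;> simp
  have hval : (pairExp a b).support.val =
      a.support.val.map Sum.inl + b.support.val.map Sum.inr := by
    rw [h, ← Finset.disjUnion_eq_union _ _ hd]
    rfl
  have h1 : shape ((pairExp a b).embDomain e.symm.toEmbedding) =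
      (pairExp a b).support.val.map (pairExp a b) := by
    rw [shape, Finsupp.support_embDomain, Finset.map_val, Multiset.map_map]
    refine Multiset.map_congr rfl fun i _ => ?_
    exact Finsupp.embDomain_apply_self _ _ _
  rw [h1, hval, Multiset.map_add, Multiset.map_map, Multiset.map_map]
  simp only [Function.comp_def, pairExp_inl, pairExp_inr]
  rfl

theorem twoAlphabets_comul (e : ℕ ≃ ℕ ⊕ ℕ) (f : Sym) :
    twoAlphabets (Coalgebra.comul (R := ℚ) f) =
      MvPowerSeries.renameEquiv ℚ e (f : MvPowerSeries ℕ ℚ) := by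
  have : twoAlphabets.toLinearMap ∘ₗ (Coalgebra.comul (R := ℚ) (A := Sym)) =
      (MvPowerSeries.renameEquiv ℚ e).toLinearMap ∘ₗ Sym.val.toLinearMap := by
    refine monoBasis.ext fun l => ?_
    simp only [monoBasis_apply, LinearMap.comp_apply, comul_monoSym, map_sum]
    ext c
    obtain ⟨a, b, rfl⟩ := exists_pairExp c
    simp only [map_sum, AlgHom.toLinearMap_apply, coeff_twoAlphabets, symCoeff_monoSym]
    have hc : pairExp a b = ((pairExp a b).embDomain e.symm.toEmbedding).embDomain
        e.toEmbedding := by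
      ext i
      obtain ⟨j, rfl⟩ := e.surjective i
      rw [show e j = e.toEmbedding j from rfl, Finsupp.embDomain_apply_self]
      conv_lhs => rw [show e.toEmbedding j = e j from rfl]
      have := Finsupp.embDomain_apply_self e.symm.toEmbedding (pairExp a b) (e j)
      rw [← this]
      simp
    have hr : MvPowerSeries.coeff (pairExp a b)
        ((MvPowerSeries.renameEquiv ℚ e).toLinearMap (Sym.val (monoSym l))) =
        if shape a + shape b = l.parts then 1 else 0 := by
      rw [hc, ← shape_pairExp e, ← coeff_monoSymSeries]
      exact MvPowerSeries.coeff_embDomain_rename e.toEmbedding _ _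
    rw [hr]
    obtain ⟨μ, hμ⟩ := exists_part a
    obtain ⟨ν, hν⟩ := exists_part b
    have hadd : shape a + shape b = (μ + ν).parts := by
      rw [← hμ, ← hν]; exact (Multiset.map_add _ _ _).symm
    rw [hadd]
    simp only [← hμ, ← hν, IntPart.parts_injective.eq_iff]
    split_ifs with h
    · rw [Finset.sum_eq_single_of_mem (μ, ν) (IntPart.mem_splittings.2 h)]
      · simp
      · rintro ⟨x, y⟩ _ hne
        by_cases h1 : μ = x
        · by_cases h2 : ν = y
          · exact absurd (by rw [h1, h2]) hne
          · simp [h2]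
        · simp [h1]
    · refine Finset.sum_eq_zero ?_
      rintro ⟨x, y⟩ hxy
      rw [IntPart.mem_splittings] at hxy
      by_cases h1 : μ = x
      · by_cases h2 : ν = y
        · exact absurd (by rw [h1, h2]; exact hxy) h
        · simp [h2]
      · simp [h1]
  exact LinearMap.congr_fun this f

theorem monoSym_zero : monoSym 0 = 1 := Subtype.ext monoSymSeries_zero

instance : Bialgebra ℚ Sym :=
  Bialgebra.mk' ℚ Sym
    (by
      change symCounit 1 = 1
      rw [← monoSym_zero, symCounit_mono, if_pos rfl])
    (by
      intro f g
      exact map_mul (MvPowerSeries.constantCoeff (σ := ℕ) (R := ℚ)) f.1 g.1)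
    (by
      obtain ⟨e⟩ : Nonempty (ℕ ≃ ℕ ⊕ ℕ) := nonempty_equiv_of_countable
      refine twoAlphabets_injective ?_
      rw [map_one twoAlphabets]
      refine (twoAlphabets_comul e 1).trans ?_
      simp)
    (by
      intro f g
      obtain ⟨e⟩ : Nonempty (ℕ ≃ ℕ ⊕ ℕ) := nonempty_equiv_of_countable
      refine twoAlphabets_injective ?_
      rw [map_mul twoAlphabets]
      refine (twoAlphabets_comul e (f * g)).trans ?_
      rw [Subalgebra.coe_mul, map_mul, ← twoAlphabets_comul, ← twoAlphabets_comul])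

theorem convMul_monoSym (f g : WithConv (Sym →ₗ[ℚ] Sym)) (l : IntPart) :
    (f * g).ofConv (monoSym l) =
      ∑ p ∈ l.splittings, f.ofConv (monoSym p.1) * g.ofConv (monoSym p.2) := by
  change (f * g) (monoSym l) = _
  rw [LinearMap.convMul_apply, comul_monoSym]
  simp

/-- `uε - id` in the convolution algebra of endomorphisms of `Sym`. -/
def convDefect : WithConv (Sym →ₗ[ℚ] Sym) := 1 - WithConv.toConv LinearMap.id

theorem convDefect_pow (k : ℕ) (l : IntPart) (h : Multiset.card l < k) :
    (convDefect ^ k).ofConv (monoSym l) = 0 := by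
  induction k generalizing l with
  | zero => omega
  | succ k ih =>
    rw [pow_succ', convMul_monoSym]
    refine Finset.sum_eq_zero ?_
    rintro ⟨a, b⟩ hab
    rw [IntPart.mem_splittings] at hab
    by_cases ha : a = 0
    · have : convDefect.ofConv (monoSym a) = 0 := by
        rw [ha]
        change algebraMap ℚ Sym (Coalgebra.counit (R := ℚ) (monoSym 0)) - monoSym 0 = 0
        rw [counit_monoSym, if_pos rfl, map_one, monoSym_zero, sub_self]
      rw [this, zero_mul]
    · rw [ih b, mul_zero]
      have h1 : Multiset.card l = Multiset.card a + Multiset.card b := by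
        rw [← hab]; exact Multiset.card_add _ _
      have h2 : 0 < Multiset.card a := Multiset.card_pos.2 ha
      omega

/-- The antipode of `Sym`, the geometric series `∑_k (uε - id)^k` for the convolution product
(only finitely many terms are nonzero on each element). -/
def symAntipode : Sym →ₗ[ℚ] Sym :=
  monoBasis.constr ℚ fun l =>
    (∑ k ∈ Finset.range (Multiset.card l + 1), convDefect ^ k).ofConv (monoSym l)

theorem ofConv_sum_apply {ι : Type*} (s : Finset ι) (f : ι → WithConv (Sym →ₗ[ℚ] Sym)) (x : Sym) :
    (∑ i ∈ s, f i).ofConv x = ∑ i ∈ s, (f i).ofConv x := by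
  classical
  induction s using Finset.induction_on with
  | empty => simp
  | insert a s ha ih => rw [Finset.sum_insert ha, Finset.sum_insert ha, ← ih]; rfl

theorem symAntipode_mono (l : IntPart) (N : ℕ) (h : Multiset.card l ≤ N) :
    symAntipode (monoSym l) =
      (∑ k ∈ Finset.range (N + 1), convDefect ^ k).ofConv (monoSym l) := by
  rw [← monoBasis_apply, symAntipode, Module.Basis.constr_basis, monoBasis_apply,
    ofConv_sum_apply, ofConv_sum_apply]
  refine Finset.sum_subset ?_ ?_
  · intro k hk
    rw [Finset.mem_range] at hk ⊢
    omega
  · intro k _ hk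
    rw [Finset.mem_range] at hk
    exact convDefect_pow k l (by omega)

theorem convDefect_final (l : IntPart) :
    (1 - convDefect ^ (Multiset.card l + 1)).ofConv (monoSym l) =
      algebraMap ℚ Sym (Coalgebra.counit (R := ℚ) (monoSym l)) := by
  change algebraMap ℚ Sym (Coalgebra.counit (R := ℚ) (monoSym l)) -
    (convDefect ^ (Multiset.card l + 1)).ofConv (monoSym l) = _
  rw [convDefect_pow _ _ (Nat.lt_succ_self _), sub_zero]

theorem geomSum_convDefect (n : ℕ) :
    (∑ k ∈ Finset.range n, convDefect ^ k) * WithConv.toConv LinearMap.id =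
      1 - convDefect ^ n := by
  have h : 1 - convDefect = WithConv.toConv LinearMap.id :=
    sub_sub_cancel (1 : WithConv (Sym →ₗ[ℚ] Sym)) _
  rw [← h]
  exact geom_sum_mul_neg convDefect n

theorem convDefect_geomSum (n : ℕ) :
    WithConv.toConv LinearMap.id * (∑ k ∈ Finset.range n, convDefect ^ k) =
      1 - convDefect ^ n := by
  have h : 1 - convDefect = WithConv.toConv LinearMap.id :=
    sub_sub_cancel (1 : WithConv (Sym →ₗ[ℚ] Sym)) _
  rw [← h]
  exact mul_neg_geom_sum convDefect n

instance : HopfAlgebra ℚ Sym where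
  antipode := symAntipode
  mul_antipode_rTensor_comul := by
    refine monoBasis.ext fun l => ?_
    rw [monoBasis_apply, LinearMap.comp_apply, LinearMap.comp_apply, comul_monoSym,
      LinearMap.comp_apply, Algebra.linearMap_apply, ← convDefect_final,
      ← geomSum_convDefect, convMul_monoSym, map_sum, map_sum]
    refine Finset.sum_congr rfl ?_
    rintro ⟨a, b⟩ hab
    rw [IntPart.mem_splittings] at hab
    rw [LinearMap.rTensor_tmul, LinearMap.mul'_apply, symAntipode_mono a (Multiset.card l)]
    · rfl
    · rw [← hab]
      exact Multiset.card_le_card (Multiset.le_add_right _ _)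
  mul_antipode_lTensor_comul := by
    refine monoBasis.ext fun l => ?_
    rw [monoBasis_apply, LinearMap.comp_apply, LinearMap.comp_apply, comul_monoSym,
      LinearMap.comp_apply, Algebra.linearMap_apply, ← convDefect_final,
      ← convDefect_geomSum, convMul_monoSym, map_sum, map_sum]
    refine Finset.sum_congr rfl ?_
    rintro ⟨a, b⟩ hab
    rw [IntPart.mem_splittings] at hab
    rw [LinearMap.lTensor_tmul, LinearMap.mul'_apply, symAntipode_mono b (Multiset.card l)]
    · rfl
    · rw [← hab]
      exact Multiset.card_le_card (Multiset.le_add_left _ _)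

/-! ### The grading and the character -/

/-- The homogeneous component of degree `n` of `Sym`. -/
def symGrading (n : ℕ) : Submodule ℚ Sym where
  carrier := {f | ∀ a : ℕ →₀ ℕ, a.degree ≠ n → symCoeff a f = 0}
  zero_mem' := fun a _ => map_zero _
  add_mem' := fun hf hg a ha => by rw [map_add, hf a ha, hg a ha, add_zero]
  smul_mem' := fun c f hf a ha => by rw [map_smul, hf a ha, smul_zero]

theorem mem_symGrading {n : ℕ} {f : Sym} :
    f ∈ symGrading n ↔ ∀ a : ℕ →₀ ℕ, a.degree ≠ n → symCoeff a f = 0 := Iff.rfl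

theorem monoSym_mem (l : IntPart) : monoSym l ∈ symGrading l.parts.sum := by
  intro a ha
  rw [symCoeff_monoSym, if_neg]
  intro h
  exact ha (by rw [← h, sum_shape])

theorem symCoeff_directSum (x : DirectSum ℕ fun n => symGrading n) (a : ℕ →₀ ℕ) :
    symCoeff a (DirectSum.coeLinearMap symGrading x) = symCoeff a (x a.degree : Sym) := by
  induction x using DirectSum.induction_on with
  | zero => simp
  | of n f =>
    rw [DirectSum.coeLinearMap_of]
    by_cases h : n = a.degree
    · subst h
      rw [DirectSum.of_eq_same]
    · rw [DirectSum.of_eq_of_ne _ _ _ (Ne.symm h), f.2 a (Ne.symm h)]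
      simp
  | add x y hx hy =>
    rw [map_add, map_add, hx, hy, DirectSum.add_apply, Submodule.coe_add, map_add]

instance : DirectSum.Decomposition symGrading :=
  have left : DirectSum.coeLinearMap symGrading ∘ₗ (monoBasis.constr ℚ fun l =>
      DirectSum.lof ℚ ℕ (fun n => symGrading n) l.parts.sum ⟨monoSym l, monoSym_mem l⟩) = .id := by
    refine monoBasis.ext fun l => ?_
    rw [LinearMap.comp_apply, Module.Basis.constr_basis, DirectSum.coeLinearMap_lof,
      monoBasis_apply]
    rfl
  have inj : Function.Injective (DirectSum.coeLinearMap symGrading) := by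
    intro x y hxy
    refine DFinsupp.ext fun n => Subtype.ext (Sym_ext fun a => ?_)
    by_cases h : a.degree = n
    · subst h
      rw [← symCoeff_directSum x a, ← symCoeff_directSum y a, hxy]
    · rw [(x n).2 a h, (y n).2 a h]
  DirectSum.Decomposition.ofLinearMap symGrading _ left (by
    refine LinearMap.ext fun x => inj ?_
    exact LinearMap.congr_fun left (DirectSum.coeLinearMap symGrading x))

instance : GradedAlgebra symGrading where
  one_mem := by
    rw [← monoSym_zero]
    exact monoSym_mem 0
  mul_mem := by
    intro i j f g hf hg a ha
    change MvPowerSeries.coeff a (f.1 * g.1) = 0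
    rw [MvPowerSeries.coeff_mul]
    refine Finset.sum_eq_zero fun p hp => ?_
    rw [Finset.HasAntidiagonal.mem_antidiagonal] at hp
    rw [← hp, map_add] at ha
    by_cases h1 : p.1.degree = i
    · have : MvPowerSeries.coeff p.2 g.1 = 0 := hg p.2 (by omega)
      rw [this, mul_zero]
    · have : MvPowerSeries.coeff p.1 f.1 = 0 := hf p.1 h1
      rw [this, zero_mul]

/-- The value of a symmetric function at `x₀ = 1` and `x_i = 0` for `i ≠ 0`: the sum of the
coefficients of the powers of `x₀` (only finitely many of which are nonzero). -/
def evalOne (f : Sym) : ℚ := ∑ᶠ n : ℕ, symCoeff (Finsupp.single 0 n) f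

theorem exists_poly (f : Sym) : ∃ P : Polynomial ℚ,
    ∀ n, P.coeff n = symCoeff (Finsupp.single 0 n) f := by
  obtain ⟨⟨N, hN⟩, -⟩ := (mem_Sym_iff f.1).1 f.2
  refine ⟨∑ n ∈ Finset.range (N + 1), Polynomial.monomial n (symCoeff (Finsupp.single 0 n) f),
    fun n => ?_⟩
  rw [Polynomial.finsetSum_coeff]
  simp only [Polynomial.coeff_monomial, Finset.sum_ite_eq', Finset.mem_range]
  split_ifs with h
  · rfl
  · exact (hN _ (by rw [Finsupp.degree_single]; omega)).symm

theorem evalOne_eq {f : Sym} {P : Polynomial ℚ}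
    (h : ∀ n, P.coeff n = symCoeff (Finsupp.single 0 n) f) : evalOne f = P.eval 1 := by
  rw [evalOne, Polynomial.eval_eq_sum, Polynomial.sum]
  simp only [← h, one_pow, mul_one]
  refine finsum_eq_sum_of_support_subset _ ?_
  intro n hn
  simpa using hn

/-- The character `ζ_S` of `Sym`: evaluation at `x₀ = 1` and `x_i = 0` for `i ≠ 0`. -/
def zetaS : Sym →ₐ[ℚ] ℚ :=
  AlgHom.ofLinearMap
    { toFun := evalOne
      map_add' := fun f g => by
        obtain ⟨P, hP⟩ := exists_poly f
        obtain ⟨Q, hQ⟩ := exists_poly g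
        rw [evalOne_eq hP, evalOne_eq hQ, ← Polynomial.eval_add]
        exact evalOne_eq fun n => by rw [Polynomial.coeff_add, hP, hQ, map_add]
      map_smul' := fun c f => by
        obtain ⟨P, hP⟩ := exists_poly f
        rw [evalOne_eq hP, RingHom.id_apply, ← Polynomial.eval_smul]
        exact evalOne_eq fun n => by rw [Polynomial.coeff_smul, hP, map_smul] }
    (by
      have : ∀ n, (1 : Polynomial ℚ).coeff n = symCoeff (Finsupp.single 0 n) 1 := by
        intro n
        change _ = MvPowerSeries.coeff (Finsupp.single 0 n) (1 : MvPowerSeries ℕ ℚ)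
        rw [MvPowerSeries.coeff_one, Polynomial.coeff_one]
        simp
      exact (evalOne_eq this).trans Polynomial.eval_one)
    (by
      intro f g
      obtain ⟨P, hP⟩ := exists_poly f
      obtain ⟨Q, hQ⟩ := exists_poly g
      change evalOne (f * g) = evalOne f * evalOne g
      rw [evalOne_eq hP, evalOne_eq hQ, ← Polynomial.eval_mul]
      refine evalOne_eq fun n => ?_
      change _ = MvPowerSeries.coeff (Finsupp.single 0 n) (f.1 * g.1)
      rw [Polynomial.coeff_mul, MvPowerSeries.coeff_mul, Finsupp.antidiagonal_single,
        Finset.sum_map]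
      refine Finset.sum_congr rfl fun p _ => ?_
      rw [hP, hQ]
      rfl)

/-! ### Power sums and Schur's `q`-functions -/

/-- The power sum `p_n = m_{(n)}`. -/
def powerSum (n : ℕ+) : Sym := monoSym {n}

/-- `p_λ`, the product of the power sums of the parts of `λ`. -/
def powerSumPart (l : IntPart) : Sym := (l.map powerSum).prod

/-- The elementary symmetric function `e_n = m_{(1, …, 1)}`. -/
def elemSym (n : ℕ) : Sym := monoSym (Multiset.replicate n 1)

/-- The complete homogeneous symmetric function `h_n`, the sum of all monomials of degree `n`. -/
def completeSym (n : ℕ) : Sym :=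
  ⟨fun a : ℕ →₀ ℕ => if a.degree = n then 1 else 0, by
    have hc : ∀ a : ℕ →₀ ℕ, MvPowerSeries.coeff a
      (fun a : ℕ →₀ ℕ => if a.degree = n then (1 : ℚ) else 0) =
        if a.degree = n then 1 else 0 := fun a => rfl
    refine (mem_Sym_iff _).2 ⟨⟨n, fun a ha => ?_⟩, fun a b h => ?_⟩
    · rw [hc, if_neg (by omega)]
    · rw [hc, hc, ← sum_shape, ← sum_shape, h]⟩

/-- Schur's function `q_n = ∑_{i=0}^n e_i h_{n-i}`, i.e. the coefficient of `t ^ n` in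
`∏_i (1 + x_i t) / (1 - x_i t)`. -/
def schurq (n : ℕ) : Sym := ∑ i ∈ Finset.range (n + 1), elemSym i * completeSym (n - i)

/-- The algebra of Schur `Q`-functions over `ℚ`: the subalgebra of `Sym` generated by the `q_n`,
`n ≥ 1`. -/
def schurQAlgebra : Subalgebra ℚ Sym := Algebra.adjoin ℚ {f | ∃ n : ℕ, 1 ≤ n ∧ f = schurq n}

end CombHopf

end

open scoped TensorProduct

noncomputable section

namespace CombHopf

/-! ### Coefficients of products of power sums -/

/-! Both subalgebras are determined by duality. If a functional ψ vanishes on a subcoalgebra C, then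
so does φ * ψ for every φ, because Δ(C) ⊆ C ⊗ C (`IsGradedSubcoalgebra.coord_eq_zero`). For the
basis (m_λ), and also for (p_λ), the convolution of the coordinates at s and t is a nonzero multiple
of the coordinate at s ⊔ t. Hence, once the coordinate at the one-part partition (n) vanishes on C,
so does the coordinate at every partition with a part n.

Even case: on degree n, ζ_S is the coordinate at m_(n). For odd n the defining condition reads -ζ_S
= ζ_S there, so this coordinate vanishes and only the even m_λ survive; their span does satisfy the
conditions (`evenSubalgebra_eq`).

Odd case: on a subcoalgebra, ζ̄ = ζ⁻¹ amounts to ζ * ζ̄ = ε (`eq_convInverse_iff`). Power sums are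
primitive and ζ_S(p_n) = 1, so ζ * ζ̄ sends p_λ to the product of the 1 + (-1)^(λ_i): it is 0 if
some part is odd and 2^k if all k parts are even. Induction on the even number n then kills the
coordinate at p_(n) (`powerBasis_coord_even_eq_zero`), and the odd p_λ do satisfy the conditions
(`oddSubalgebra_eq`).

The remaining descriptions are compared with these. Newton's identity n q_n = 2 ∑ p_r q_(n-r), r
odd, expresses the q_n through the odd power sums and back. The coefficients of the η_λ have a
generating function multiplicative in the shape of the monomial (`etaGen`), so Δ acts on the η_λ as
on the m_λ; then ζ * ζ̄ on η_λ, λ odd, is an alternating sum equal to 0 unless λ is empty. Finally,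
the p_λ and the η_λ are triangular in the m_λ with respect to the number of parts, hence
independent, and a dimension count in each degree (`span_eq_of_linearIndependent`) turns inclusions
of spans into equalities. -/

theorem monoBasis_coord {a : ℕ →₀ ℕ} {l : IntPart} (h : shape a = l.parts) :
    monoBasis.coord l = symCoeff a := by
  refine monoBasis.ext fun μ => ?_
  rw [Module.Basis.coord_apply, Module.Basis.repr_self, monoBasis_apply, symCoeff_monoSym, h,
    Finsupp.single_apply]
  simp only [IntPart.parts_injective.eq_iff, eq_comm]

theorem card_shape (a : ℕ →₀ ℕ) : Multiset.card (shape a) = a.support.card := by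
  simp [shape]

theorem card_parts (l : IntPart) : Multiset.card l.parts = Multiset.card l :=
  Multiset.card_map _ _

theorem parts_cons (n : ℕ+) (l : IntPart) : IntPart.parts (n ::ₘ l) = (n : ℕ) ::ₘ l.parts :=
  Multiset.map_cons _ _ _

theorem shape_eq_cons {a : ℕ →₀ ℕ} {i : ℕ} (hi : i ∈ a.support) :
    shape a = a i ::ₘ shape (a - Finsupp.single i (a i)) := by
  have hs : (a - Finsupp.single i (a i)).support = a.support.erase i := by
    ext j
    by_cases h : j = i
    · subst h; simp
    · simp [h]
  rw [shape, shape, hs, Finset.erase_val, ← Multiset.cons_erase ((show i ∈ a.support.val from hi)),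
    Multiset.map_cons]
  congr 1
  rw [Multiset.erase_cons_head]
  refine Multiset.map_congr rfl fun j hj => ?_
  have hji : j ≠ i := by
    rintro rfl
    exact (Multiset.Nodup.notMem_erase a.support.nodup) hj
  simp [hji.symm]

theorem shape_single (i n : ℕ) (hn : n ≠ 0) : shape (Finsupp.single i n) = {n} := by
  rw [shape, Finsupp.support_single _ hn]
  simp

theorem shape_eq_singleton {a : ℕ →₀ ℕ} {n : ℕ} (h : shape a = {n}) :
    ∃ i, a = Finsupp.single i n := by
  have hc : a.support.card = 1 := by rw [← card_shape, h]; rfl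
  obtain ⟨i, hi⟩ := Finset.card_eq_one.1 hc
  refine ⟨i, ?_⟩
  rw [shape, hi] at h
  simp only [Finset.singleton_val, Multiset.map_singleton, Multiset.singleton_inj] at h
  rw [← h]
  ext j
  by_cases hj : i = j
  · subst hj; simp
  · rw [Finsupp.single_eq_of_ne' hj]
    by_contra h0
    have := Finsupp.mem_support_iff.2 h0
    rw [hi, Finset.mem_singleton] at this
    exact hj this.symm

/-- As p_n is the sum of the x_i^n, each contribution removes x_i^n from x^a for some i where this
is possible. This recursion drives every induction on power sum products below. -/
theorem symCoeff_powerSum_mul (a : ℕ →₀ ℕ) (n : ℕ+) (f : Sym) :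
    symCoeff a (powerSum n * f) =
      ∑ i ∈ a.support with (n : ℕ) ≤ a i, symCoeff (a - Finsupp.single i (n : ℕ)) f := by
  classical
  have h : symCoeff a (powerSum n * f) = ∑ p ∈ Finset.HasAntidiagonal.antidiagonal a,
      if shape p.1 = {(n : ℕ)} then symCoeff p.2 f else 0 := by
    change MvPowerSeries.coeff a ((powerSum n).1 * f.1) = _
    rw [MvPowerSeries.coeff_mul]
    refine Finset.sum_congr rfl fun p _ => ?_
    have h1 : MvPowerSeries.coeff p.1 (powerSum n).1 = if shape p.1 = {(n : ℕ)} then 1 else 0 :=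
      symCoeff_monoSym p.1 {n}
    rw [h1, ite_mul, one_mul, zero_mul]
    rfl
  rw [h, ← Finset.sum_filter]
  symm
  refine Finset.sum_nbij (fun i => (Finsupp.single i (n : ℕ), a - Finsupp.single i (n : ℕ)))
    ?_ ?_ ?_ (fun _ _ => rfl)
  · intro i hi
    simp only [Finset.mem_filter, Finset.HasAntidiagonal.mem_antidiagonal] at hi ⊢
    refine ⟨add_tsub_cancel_of_le ?_, shape_single _ _ n.ne_zero⟩
    rw [Finsupp.single_le_iff]
    exact hi.2
  · intro i _ j _ hij
    exact Finsupp.single_left_injective n.ne_zero (congrArg Prod.fst hij)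
  · rintro ⟨p, q⟩ hp
    simp only [Finset.coe_filter, Set.mem_ofPred_eq, Finset.HasAntidiagonal.mem_antidiagonal] at hp
    obtain ⟨rfl, hp⟩ := hp
    obtain ⟨i, rfl⟩ := shape_eq_singleton hp
    refine ⟨i, ?_, ?_⟩
    · rw [Finset.mem_coe, Finset.mem_filter]
      simp
    · simp

theorem powerSumPart_cons (n : ℕ+) (l : IntPart) :
    powerSumPart (n ::ₘ l) = powerSum n * powerSumPart l := by
  rw [powerSumPart, Multiset.map_cons, Multiset.prod_cons, powerSumPart]

theorem powerSumPart_zero : powerSumPart 0 = 1 := by simp [powerSumPart]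

theorem powerSumPart_singleton (n : ℕ+) : powerSumPart {n} = powerSum n := by
  simp [powerSumPart]

theorem powerSumPart_mem (l : IntPart) : powerSumPart l ∈ symGrading l.parts.sum := by
  induction l using Multiset.induction_on with
  | empty =>
    rw [powerSumPart_zero]
    exact SetLike.GradedOne.one_mem
  | cons n l ih =>
    rw [powerSumPart_cons, parts_cons, Multiset.sum_cons]
    refine SetLike.mul_mem_graded ?_ ih
    simpa [IntPart.parts, powerSum] using monoSym_mem {n}

theorem symCoeff_powerSumPart_nonneg (l : IntPart) (a : ℕ →₀ ℕ) :
    0 ≤ symCoeff a (powerSumPart l) := by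
  induction l using Multiset.induction_on generalizing a with
  | empty =>
    rw [powerSumPart_zero, ← monoSym_zero, symCoeff_monoSym]
    split_ifs <;> norm_num
  | cons n l ih =>
    rw [powerSumPart_cons, symCoeff_powerSum_mul]
    exact Finset.sum_nonneg fun i _ => ih _

theorem support_sub_single {a : ℕ →₀ ℕ} {i n : ℕ} (hn : n < a i) :
    (a - Finsupp.single i n).support = a.support := by
  ext j
  by_cases h : i = j
  · subst h
    simp
    omega
  · simp [h]

/-- A monomial of p_λ arises by distributing the parts of λ among the variables. It involves at most
as many variables as λ has parts, with equality only if every variable receives a single part, and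
then its shape is λ. In the recursion, removing x_i^n either deletes a variable or leaves the
support unchanged while λ gets shorter. -/
theorem symCoeff_powerSumPart_eq_zero (l : IntPart) (a : ℕ →₀ ℕ) (h : shape a ≠ l.parts)
    (hc : Multiset.card l ≤ a.support.card) : symCoeff a (powerSumPart l) = 0 := by
  induction l using Multiset.induction_on generalizing a with
  | empty =>
    rw [powerSumPart_zero, ← monoSym_zero, symCoeff_monoSym, if_neg h]
  | cons n l ih =>
    rw [powerSumPart_cons, symCoeff_powerSum_mul]
    refine Finset.sum_eq_zero fun i hi => ?_
    rw [Finset.mem_filter] at hi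
    rw [Multiset.card_cons] at hc
    rcases hi.2.eq_or_lt with he | hlt
    · have hs := shape_eq_cons hi.1
      rw [he]
      apply ih
      · intro h'
        rw [h', ← he] at hs
        exact h (by rw [hs, parts_cons])
      · have := congrArg Multiset.card hs
        rw [Multiset.card_cons, card_shape, card_shape] at this
        omega
    · have hs := support_sub_single hlt
      apply ih
      · intro h'
        have := congrArg Multiset.card h'
        rw [card_shape, hs, card_parts] at this
        omega
      · rw [hs]; omega

/-- All terms of the recursion are nonnegative, so one positive term suffices: remove n from a
variable whose exponent is exactly n. -/
theorem symCoeff_powerSumPart_pos (l : IntPart) (a : ℕ →₀ ℕ) (h : shape a = l.parts) :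
    0 < symCoeff a (powerSumPart l) := by
  induction l using Multiset.induction_on generalizing a with
  | empty =>
    rw [powerSumPart_zero, ← monoSym_zero, symCoeff_monoSym, if_pos h]
    norm_num
  | cons n l ih =>
    rw [powerSumPart_cons, symCoeff_powerSum_mul]
    have hn : (n : ℕ) ∈ shape a := by rw [h, parts_cons]; exact Multiset.mem_cons_self _ _
    obtain ⟨i, hi, hin⟩ := Multiset.mem_map.1 hn
    refine Finset.sum_pos' (fun i _ => symCoeff_powerSumPart_nonneg _ _) ⟨i, ?_, ih _ ?_⟩
    · rw [Finset.mem_filter]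
      exact ⟨hi, hin.ge⟩
    · have hs := shape_eq_cons hi
      rw [h, parts_cons, hin] at hs
      exact ((Multiset.cons_inj_right _).1 hs).symm

/-- Removing even powers never changes the parity of an exponent, so an odd exponent cannot be
exhausted. -/
theorem symCoeff_powerSumPart_even (l : IntPart) (hl : l.IsEven) (a : ℕ →₀ ℕ) {j : ℕ}
    (hj : Odd (a j)) : symCoeff a (powerSumPart l) = 0 := by
  induction l using Multiset.induction_on generalizing a with
  | empty =>
    rw [powerSumPart_zero, ← monoSym_zero, symCoeff_monoSym, if_neg]
    intro h
    have h0 : shape a = 0 := h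
    have : a.support = ∅ := by
      rw [← Finset.card_eq_zero, ← card_shape, h0, Multiset.card_zero]
    rw [Finsupp.support_eq_empty] at this
    simp [this] at hj
  | cons n l ih =>
    rw [powerSumPart_cons, symCoeff_powerSum_mul]
    refine Finset.sum_eq_zero fun i hi => ih (fun m hm => hl m (Multiset.mem_cons_of_mem hm)) _ ?_
    rw [Finset.mem_filter] at hi
    have hn : Even (n : ℕ) := hl n (Multiset.mem_cons_self _ _)
    rw [Finsupp.tsub_apply, Finsupp.single_apply]
    split_ifs with hij
    · subst hij
      exact Nat.Odd.sub_even hi.2 hj hn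
    · simpa using hj

/-! ### Triangular families and spanning by dimension -/

theorem finite_parts_sum (n : ℕ) : {l : IntPart | l.parts.sum = n}.Finite := by
  refine ((IntComp.finite_size n).image
    (fun α : IntComp => ((α : Multiset ℕ+) : IntPart))).subset fun l hl => ?_
  induction l using Quotient.inductionOn with
  | h L => exact ⟨L, by simpa [IntPart.parts, IntComp.size] using hl, rfl⟩

/-- In a linear relation, take a partition with the largest number of parts among those with nonzero
coefficient. Its coordinate annihilates every other term, so that coefficient must vanish. -/
theorem linearIndependent_of_triangular {T : Set IntPart} {v : IntPart → Sym}
    (h0 : ∀ l ∈ T, ∀ μ ∈ T, l ≠ μ → Multiset.card μ ≤ Multiset.card l →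
      monoBasis.coord l (v μ) = 0)
    (h1 : ∀ l ∈ T, monoBasis.coord l (v l) ≠ 0) :
    LinearIndependent ℚ fun l : T => v l := by
  classical
  rw [linearIndependent_iff']
  intro s c hc
  by_contra! hne
  obtain ⟨l, hl, hmax⟩ := (s.filter fun i => c i ≠ 0).exists_max_image
    (fun i => Multiset.card i.1) (by
      obtain ⟨i, hi, hi0⟩ := hne
      exact ⟨i, Finset.mem_filter.2 ⟨hi, hi0⟩⟩)
  rw [Finset.mem_filter] at hl
  have := congrArg (monoBasis.coord l.1) hc
  rw [map_sum, map_zero, Finset.sum_eq_single_of_mem l hl.1, map_smul, smul_eq_mul] at this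
  · exact mul_ne_zero hl.2 (h1 _ l.2) this
  · intro μ hμ hne
    rw [map_smul, smul_eq_mul]
    by_cases hc0 : c μ = 0
    · rw [hc0, zero_mul]
    · rw [h0 l.1 l.2 μ.1 μ.2 (fun h => hne (Subtype.ext h.symm))
        (hmax μ (Finset.mem_filter.2 ⟨hμ, hc0⟩)), mul_zero]

/-- In each degree T contains finitely many partitions. There the independent `w l` lie in the span
of equally many vectors `v l`, so the two spans have the same dimension and coincide. Independence
of `v` is not needed. -/
theorem span_eq_of_linearIndependent {T : Set IntPart} {v w : IntPart → Sym}
    (hw : LinearIndependent ℚ fun l : T => w l)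
    (h : ∀ l ∈ T, w l ∈ Submodule.span ℚ (v '' {μ ∈ T | μ.parts.sum = l.parts.sum})) :
    Submodule.span ℚ (w '' T) = Submodule.span ℚ (v '' T) := by
  classical
  refine le_antisymm (Submodule.span_le.2 ?_) (Submodule.span_le.2 ?_)
  · rintro _ ⟨l, hl, rfl⟩
    exact Submodule.span_mono (Set.image_mono fun μ hμ => hμ.1) (h l hl)
  · rintro _ ⟨l, hl, rfl⟩
    set D : Set IntPart := {μ ∈ T | μ.parts.sum = l.parts.sum} with hD
    have hfin : D.Finite := (finite_parts_sum l.parts.sum).subset fun μ hμ => hμ.2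
    have : Fintype D := hfin.fintype
    have hle : Submodule.span ℚ (w '' D) ≤ Submodule.span ℚ (v '' D) := by
      refine Submodule.span_le.2 ?_
      rintro _ ⟨μ, hμ, rfl⟩
      have := h μ hμ.1
      rwa [hμ.2] at this
    have hwD : LinearIndependent ℚ fun μ : D => w μ :=
      hw.comp (fun μ : D => (⟨μ.1, μ.2.1⟩ : T)) fun x y hxy => by
        simpa [Subtype.ext_iff] using hxy
    have hcard : Module.finrank ℚ (Submodule.span ℚ (w '' D)) = Fintype.card D := by
      rw [Set.image_eq_range]
      exact finrank_span_eq_card hwD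
    have hcard' : Module.finrank ℚ (Submodule.span ℚ (v '' D)) ≤ Fintype.card D := by
      rw [Set.image_eq_range]
      exact finrank_range_le_card _
    have : FiniteDimensional ℚ (Submodule.span ℚ (v '' D)) :=
      FiniteDimensional.span_of_finite ℚ (hfin.image v)
    have heq := Submodule.eq_of_le_of_finrank_le hle (by rw [hcard]; exact hcard')
    have : v l ∈ Submodule.span ℚ (w '' D) := by
      rw [heq]
      exact Submodule.subset_span ⟨l, ⟨hl, rfl⟩, rfl⟩
    exact Submodule.span_mono (Set.image_mono fun μ hμ => hμ.1) this

theorem mem_span_image_iff_coord {ι M : Type*} [AddCommGroup M] [Module ℚ M]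
    (b : Module.Basis ι ℚ M) (s : Set ι) (f : M) :
    f ∈ Submodule.span ℚ (b '' s) ↔ ∀ i, i ∉ s → b.coord i f = 0 := by
  rw [Module.Basis.mem_span_image]
  constructor
  · intro h i hi
    by_contra h0
    exact hi (h (Finsupp.mem_support_iff.2 h0))
  · intro h i hi
    by_contra h0
    exact Finsupp.mem_support_iff.1 hi (h i h0)

theorem coe_monoBasis : ⇑monoBasis = monoSym := funext monoBasis_apply

theorem coord_eq_zero_of_mem {n : ℕ} {f : Sym} (hf : f ∈ symGrading n) {l : IntPart}
    (hl : l.parts.sum ≠ n) : monoBasis.coord l f = 0 := by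
  obtain ⟨a, ha⟩ := exists_shape l
  rw [monoBasis_coord ha]
  exact hf a (by rwa [← sum_shape, ha])

/-! ### Power sums as a basis -/

theorem linearIndependent_powerSumPart (T : Set IntPart) :
    LinearIndependent ℚ fun l : T => powerSumPart l := by
  refine linearIndependent_of_triangular (fun l _ μ _ hne hc => ?_) fun l _ => ?_
  · obtain ⟨a, ha⟩ := exists_shape l
    rw [monoBasis_coord ha]
    refine symCoeff_powerSumPart_eq_zero _ _ ?_ ?_
    · rw [ha]
      exact fun h => hne (IntPart.parts_injective h)
    · rwa [← card_shape, ha, card_parts]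
  · obtain ⟨a, ha⟩ := exists_shape l
    rw [monoBasis_coord ha]
    exact (symCoeff_powerSumPart_pos _ _ ha).ne'

theorem span_powerSumPart : Submodule.span ℚ (Set.range powerSumPart) = ⊤ := by
  have h := span_eq_of_linearIndependent (T := Set.univ) (v := monoSym)
    (linearIndependent_powerSumPart Set.univ) fun l _ => by
      rw [← coe_monoBasis, mem_span_image_iff_coord]
      intro μ hμ
      exact coord_eq_zero_of_mem (powerSumPart_mem l) fun h => hμ ⟨trivial, h⟩
  rw [Set.image_univ, Set.image_univ] at h
  rw [h, ← coe_monoBasis, monoBasis.span_eq]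

/-- The basis `(p_λ)` of `Sym`. -/
def powerBasis : Module.Basis IntPart ℚ Sym :=
  Module.Basis.mk (v := powerSumPart)
    ((linearIndependent_powerSumPart Set.univ).comp (fun l => ⟨l, trivial⟩) fun _ _ h =>
      congrArg Subtype.val h) span_powerSumPart.ge

theorem powerBasis_apply (l : IntPart) : powerBasis l = powerSumPart l := by
  simp [powerBasis]

theorem coe_powerBasis : ⇑powerBasis = powerSumPart := funext powerBasis_apply

/-- Only one inclusion is computed: an even p_λ has no monomial with an odd exponent. The other
comes from the dimension count. -/
theorem span_powerSumPart_even :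
    Submodule.span ℚ (powerSumPart '' {l | l.IsEven}) =
      Submodule.span ℚ (monoSym '' {l | l.IsEven}) := by
  refine span_eq_of_linearIndependent (linearIndependent_powerSumPart _) fun l hl => ?_
  rw [← coe_monoBasis, mem_span_image_iff_coord]
  intro μ hμ
  by_cases hd : μ.parts.sum = l.parts.sum
  · have : ¬ μ.IsEven := fun h => hμ ⟨h, hd⟩
    simp only [IntPart.IsEven, not_forall, Nat.not_even_iff_odd] at this
    obtain ⟨n, hn, hodd⟩ := this
    obtain ⟨a, ha⟩ := exists_shape μ
    rw [monoBasis_coord ha]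
    have hn' : (n : ℕ) ∈ shape a := by rw [ha]; exact Multiset.mem_map_of_mem _ hn
    obtain ⟨i, -, hi⟩ := Multiset.mem_map.1 hn'
    exact symCoeff_powerSumPart_even l hl a (j := i) (by rwa [hi])
  · exact coord_eq_zero_of_mem (powerSumPart_mem l) hd

/-! ### Graded subcoalgebras and convolution of functionals -/

section Convolution

variable {k H : Type*} [Field k] [Ring H] [HopfAlgebra k H]

/-- The functional `φ ⊗ ψ` on `H ⊗ H`. -/
def tensorFunctional (φ ψ : H →ₗ[k] k) : H ⊗[k] H →ₗ[k] k :=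
  LinearMap.mul' k k ∘ₗ TensorProduct.map φ ψ

theorem tensorFunctional_tmul (φ ψ : H →ₗ[k] k) (x y : H) :
    tensorFunctional φ ψ (x ⊗ₜ y) = φ x * ψ y := rfl

/-- On the image of C ⊗ C a functional φ ⊗ ψ depends only on the restrictions of φ and ψ to C.
Applied to Δ(h), this is how the subcoalgebra condition enters. -/
theorem tensorFunctional_congr {C : Submodule k H} {φ φ' ψ ψ' : H →ₗ[k] k}
    (hφ : ∀ h ∈ C, φ h = φ' h) (hψ : ∀ h ∈ C, ψ h = ψ' h) {x : H ⊗[k] H}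
    (hx : x ∈ LinearMap.range (TensorProduct.map C.subtype C.subtype)) :
    tensorFunctional φ ψ x = tensorFunctional φ' ψ' x := by
  obtain ⟨y, rfl⟩ := hx
  have h : tensorFunctional φ ψ ∘ₗ TensorProduct.map C.subtype C.subtype =
      tensorFunctional φ' ψ' ∘ₗ TensorProduct.map C.subtype C.subtype := by
    refine TensorProduct.ext' fun x y => ?_
    simp only [LinearMap.comp_apply, TensorProduct.map_tmul, tensorFunctional_tmul,
      Submodule.subtype_apply, hφ _ x.2, hψ _ y.2]
  exact LinearMap.congr_fun h y

/-- The convolution product of two functionals. -/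
def convFunctional (φ ψ : H →ₗ[k] k) : H →ₗ[k] k :=
  tensorFunctional φ ψ ∘ₗ Coalgebra.comul

/-- Identification with the convolution algebra, from which associativity and the unit laws are
inherited. -/
theorem convFunctional_eq (φ ψ : H →ₗ[k] k) :
    convFunctional φ ψ = (WithConv.toConv φ * WithConv.toConv ψ).ofConv := rfl

theorem convFunctional_assoc (φ ψ χ : H →ₗ[k] k) :
    convFunctional (convFunctional φ ψ) χ = convFunctional φ (convFunctional ψ χ) := by
  simp only [convFunctional_eq, WithConv.toConv_ofConv, mul_assoc]

theorem counit_eq_convOne :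
    (Coalgebra.counit : H →ₗ[k] k) = (1 : WithConv (H →ₗ[k] k)).ofConv := rfl

theorem convFunctional_counit (φ : H →ₗ[k] k) : convFunctional φ Coalgebra.counit = φ := by
  rw [counit_eq_convOne, convFunctional_eq, WithConv.toConv_ofConv, mul_one]

theorem counit_convFunctional (φ : H →ₗ[k] k) : convFunctional Coalgebra.counit φ = φ := by
  rw [counit_eq_convOne, convFunctional_eq, WithConv.toConv_ofConv, one_mul]

/-- Composition with the algebra map ζ respects convolution, so ζ * (ζ ∘ S) = ζ ∘ (id * S), and id *
S is the unit composed with the counit. -/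
theorem convFunctional_convInverse (ζ : H →ₐ[k] k) :
    convFunctional ζ.toLinearMap (convInverse ζ) = Coalgebra.counit := by
  have h := LinearMap.algHom_comp_convMul_distrib ζ (WithConv.toConv LinearMap.id)
    (WithConv.toConv (HopfAlgebra.antipode k (A := H)))
  rw [LinearMap.id_mul_antipode] at h
  refine Eq.trans h.symm (LinearMap.ext fun x => ?_)
  exact ζ.commutes _

theorem convInverse_convFunctional (ζ : H →ₐ[k] k) :
    convFunctional (convInverse ζ) ζ.toLinearMap = Coalgebra.counit := by
  have h := LinearMap.algHom_comp_convMul_distrib ζ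
    (WithConv.toConv (HopfAlgebra.antipode k (A := H))) (WithConv.toConv LinearMap.id)
  rw [LinearMap.antipode_mul_id] at h
  refine Eq.trans h.symm (LinearMap.ext fun x => ?_)
  exact ζ.commutes _

/-- On a subcoalgebra, `φ = ζ⁻¹` if and only if `ζ * φ` is the counit. -/
theorem eq_convInverse_iff {C : Submodule k H} (hC : ∀ h ∈ C, (Coalgebra.comul (R := k) h :
      H ⊗[k] H) ∈ LinearMap.range (TensorProduct.map C.subtype C.subtype))
    (ζ : H →ₐ[k] k) (φ : H →ₗ[k] k) :
    (∀ h ∈ C, φ h = convInverse ζ h) ↔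
      ∀ h ∈ C, convFunctional ζ.toLinearMap φ h = Coalgebra.counit (R := k) h := by
  constructor
  · intro hφ h hh
    rw [← convFunctional_convInverse ζ]
    exact tensorFunctional_congr (fun _ _ => rfl) hφ (hC h hh)
  · intro hφ h hh
    -- On C, φ = (ζ⁻¹ * ζ) * φ = ζ⁻¹ * (ζ * φ) = ζ⁻¹ * ε = ζ⁻¹.
    rw [← counit_convFunctional φ, ← convInverse_convFunctional ζ, convFunctional_assoc]
    conv_rhs => rw [← convFunctional_counit (convInverse ζ)]
    exact tensorFunctional_congr (fun _ _ => rfl) hφ (hC h hh)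

theorem barFunctional_of_mem (𝒜 : ℕ → Submodule k H) [DirectSum.Decomposition 𝒜]
    (φ : H →ₗ[k] k) {n : ℕ} {h : H} (hh : h ∈ 𝒜 n) :
    barFunctional 𝒜 φ h = (-1) ^ n * φ h := by
  rw [barFunctional, LinearMap.comp_apply, barInvolution, LinearMap.comp_apply,
    LinearEquiv.coe_coe, DirectSum.decomposeLinearEquiv_apply, DirectSum.decompose_of_mem 𝒜 hh]
  change φ (DirectSum.toModule k ℕ H _ (DirectSum.lof k ℕ (fun i => 𝒜 i) n ⟨h, hh⟩)) = _
  rw [DirectSum.toModule_lof]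
  simp

theorem tmul_mem_range {C : Submodule k H} {x y : H} (hx : x ∈ C) (hy : y ∈ C) :
    x ⊗ₜ[k] y ∈ LinearMap.range (TensorProduct.map C.subtype C.subtype) :=
  ⟨(⟨x, hx⟩ : C) ⊗ₜ (⟨y, hy⟩ : C), rfl⟩

theorem isGradedSubcoalgebra_span (𝒜 : ℕ → Submodule k H) [DirectSum.Decomposition 𝒜]
    {s : Set H} (hs : ∀ x ∈ s, ∃ n, x ∈ 𝒜 n)
    (hΔ : ∀ x ∈ s, (Coalgebra.comul (R := k) x : H ⊗[k] H) ∈ LinearMap.range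
      (TensorProduct.map (Submodule.span k s).subtype (Submodule.span k s).subtype)) :
    IsGradedSubcoalgebra 𝒜 (Submodule.span k s) where
  homogeneous := by
    intro h hh n
    induction hh using Submodule.span_induction with
    | mem x hx =>
      obtain ⟨m, hm⟩ := hs x hx
      rw [DirectSum.decompose_of_mem 𝒜 hm]
      by_cases hmn : m = n
      · subst hmn
        rw [DirectSum.of_eq_same]
        exact Submodule.subset_span hx
      · rw [DirectSum.of_eq_of_ne _ _ _ (Ne.symm hmn)]
        exact Submodule.zero_mem _
    | zero => simp
    | add x y _ _ hx hy =>
      rw [DirectSum.decompose_add, DirectSum.add_apply, Submodule.coe_add]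
      exact Submodule.add_mem _ hx hy
    | smul c x _ hx =>
      rw [DirectSum.decompose_smul, DirectSum.smul_apply, Submodule.coe_smul]
      exact Submodule.smul_mem _ _ hx
  comul_mem := by
    intro h hh
    induction hh using Submodule.span_induction with
    | mem x hx => exact hΔ x hx
    | zero => rw [map_zero]; exact Submodule.zero_mem _
    | add x y _ _ hx hy => rw [map_add]; exact Submodule.add_mem _ hx hy
    | smul c x _ hx => rw [map_smul]; exact Submodule.smul_mem _ _ hx

/-- As Δ(C) ⊆ C ⊗ C, on C the functional ψ may be replaced by 0 inside φ * ψ. It is applied with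
coordinates: φ at μ, ψ at (n) and χ at the union of μ and (n). -/
theorem IsGradedSubcoalgebra.coord_eq_zero {𝒜 : ℕ → Submodule k H} [DirectSum.Decomposition 𝒜]
    {C : Submodule k H} (hC : IsGradedSubcoalgebra 𝒜 C) {φ ψ χ : H →ₗ[k] k} {c : k} (hc : c ≠ 0)
    (h : convFunctional φ ψ = c • χ) (hψ : ∀ f ∈ C, ψ f = 0) : ∀ f ∈ C, χ f = 0 := by
  intro f hf
  have h1 : convFunctional φ ψ f = convFunctional φ 0 f :=
    tensorFunctional_congr (fun _ _ => rfl) hψ (hC.comul_mem f hf)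
  have h2 : convFunctional φ 0 f = 0 := by
    simp [convFunctional, tensorFunctional]
  rw [h2, h, LinearMap.smul_apply, smul_eq_mul] at h1
  exact (mul_eq_zero.1 h1).resolve_left hc

/-- The basis is homogeneous, so a coordinate sees only the component in the degree of its basis
vector. This permits passing to a homogeneous element before applying a character. -/
theorem coord_decompose (𝒜 : ℕ → Submodule k H) [DirectSum.Decomposition 𝒜] {ι : Type*}
    (b : Module.Basis ι k H) {d : ι → ℕ} (hb : ∀ i, b i ∈ 𝒜 (d i)) {i : ι} {n : ℕ} (hn : d i = n)
    (f : H) : b.coord i (DirectSum.decompose 𝒜 f n : H) = b.coord i f := by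
  have h : b.coord i ∘ₗ (𝒜 n).subtype ∘ₗ DirectSum.component k ℕ (fun i => 𝒜 i) n ∘ₗ
      (DirectSum.decomposeLinearEquiv 𝒜).toLinearMap = b.coord i := by
    refine b.ext fun j => ?_
    change b.coord i (DirectSum.decompose 𝒜 (b j) n : H) = _
    rw [DirectSum.decompose_of_mem 𝒜 (hb j), DirectSum.coe_of_apply]
    split_ifs with hij
    · rfl
    · have : j ≠ i := fun h => hij (by rw [h, hn])
      simp [this]
  exact LinearMap.congr_fun h f

end Convolution

/-! ### The coproduct and the character on the two bases -/

/-- The term m_s ⊗ m_t occurs only in Δ(m_(s ⊔ t)), and there exactly once. The scalar 1 is written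
out to match the hypothesis of `IsGradedSubcoalgebra.coord_eq_zero`. -/
theorem convFunctional_monoBasis_coord (s t : IntPart) :
    convFunctional (monoBasis.coord s) (monoBasis.coord t) =
      (1 : ℚ) • monoBasis.coord (s + t) := by
  classical
  refine monoBasis.ext fun l => ?_
  rw [one_smul, convFunctional, LinearMap.comp_apply, monoBasis_apply, comul_monoSym, map_sum]
  simp only [tensorFunctional_tmul, ← monoBasis_apply, Module.Basis.coord_apply,
    Module.Basis.repr_self, Finsupp.single_apply]
  by_cases h : l = s + t
  · rw [Finset.sum_eq_single_of_mem (s, t) (IntPart.mem_splittings.2 h.symm)]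
    · simp [h]
    · rintro ⟨a, b⟩ _ hne
      by_cases h1 : a = s
      · by_cases h2 : b = t
        · exact absurd (by rw [h1, h2]) hne
        · simp [h2]
      · simp [h1]
  · rw [if_neg h]
    refine Finset.sum_eq_zero ?_
    rintro ⟨a, b⟩ hab
    rw [IntPart.mem_splittings] at hab
    by_cases h1 : a = s
    · by_cases h2 : b = t
      · exact absurd (by rw [← hab, ← h1, ← h2]) h
      · simp [h2]
    · simp [h1]

/-- Power sums are primitive, since a one-element multiset splits in only two ways. -/
theorem comul_powerSum (n : ℕ+) : Coalgebra.comul (R := ℚ) (powerSum n) =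
    powerSum n ⊗ₜ[ℚ] 1 + 1 ⊗ₜ[ℚ] powerSum n := by
  have hs : IntPart.splittings {n} = {({n}, 0), (0, {n})} := by
    ext p
    rw [IntPart.splittings, Multiset.mem_toFinset, ← Multiset.cons_zero, Multiset.antidiagonal_cons]
    simp [or_comm]
  rw [powerSum, comul_monoSym, hs, Finset.sum_pair (by simp), monoSym_zero]

/-- Δ is multiplicative and the factors are primitive, so a product of binomials gets expanded.
Unlike `IntPart.splittings`, the multiset `antidiagonal` keeps the multiplicities caused by repeated
parts. -/
theorem comul_powerSumPart (l : IntPart) : Coalgebra.comul (R := ℚ) (powerSumPart l) =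
    (l.antidiagonal.map fun p => powerSumPart p.1 ⊗ₜ[ℚ] powerSumPart p.2).sum := by
  have h1 : ∀ μ : IntPart, (μ.map fun n => powerSum n ⊗ₜ[ℚ] (1 : Sym)).prod =
      powerSumPart μ ⊗ₜ[ℚ] 1 := by
    intro μ
    have := map_multiset_prod
      (Algebra.TensorProduct.includeLeft : Sym →ₐ[ℚ] Sym ⊗[ℚ] Sym) (μ.map powerSum)
    rw [Multiset.map_map] at this
    exact this.symm
  have h2 : ∀ μ : IntPart, (μ.map fun n => (1 : Sym) ⊗ₜ[ℚ] powerSum n).prod =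
      1 ⊗ₜ[ℚ] powerSumPart μ := by
    intro μ
    have := map_multiset_prod
      (Algebra.TensorProduct.includeRight : Sym →ₐ[ℚ] Sym ⊗[ℚ] Sym) (μ.map powerSum)
    rw [Multiset.map_map] at this
    exact this.symm
  have h : Coalgebra.comul (R := ℚ) (powerSumPart l) =
      (l.map fun n => powerSum n ⊗ₜ[ℚ] (1 : Sym) + 1 ⊗ₜ[ℚ] powerSum n).prod := by
    have := map_multiset_prod (Bialgebra.comulAlgHom ℚ Sym) (l.map powerSum)
    rw [Multiset.map_map] at this
    refine this.trans (congrArg Multiset.prod (Multiset.map_congr rfl fun n _ => ?_))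
    exact comul_powerSum n
  rw [h, Multiset.prod_map_add]
  refine congrArg Multiset.sum (Multiset.map_congr rfl fun p _ => ?_)
  rw [h1, h2, Algebra.TensorProduct.tmul_mul_tmul, one_mul, mul_one]

theorem convFunctional_powerSumPart (φ ψ : Sym →ₗ[ℚ] ℚ) (l : IntPart) :
    convFunctional φ ψ (powerSumPart l) =
      (l.antidiagonal.map fun p => φ (powerSumPart p.1) * ψ (powerSumPart p.2)).sum := by
  rw [convFunctional, LinearMap.comp_apply, comul_powerSumPart, map_multiset_sum,
    Multiset.map_map]
  rfl

/-- The scalar is the multiplicity of p_s ⊗ p_t in Δ(p_(s ⊔ t)), a positive integer and therefore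
nonzero in ℚ. -/
theorem convFunctional_powerBasis_coord (s t : IntPart) : ∃ c : ℚ, c ≠ 0 ∧
    convFunctional (powerBasis.coord s) (powerBasis.coord t) = c • powerBasis.coord (s + t) := by
  classical
  refine ⟨((Multiset.antidiagonal (s + t)).count (s, t) : ℕ), ?_, ?_⟩
  · rw [Nat.cast_ne_zero]
    exact Multiset.count_ne_zero.2 (Multiset.mem_antidiagonal.2 rfl)
  · refine powerBasis.ext fun l => ?_
    have h : ((Multiset.antidiagonal l).count (s, t) : ℚ) =
        convFunctional (powerBasis.coord s) (powerBasis.coord t) (powerBasis l) := by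
      have hcount : ∀ (M : Multiset (IntPart × IntPart)) (x : IntPart × IntPart),
          (M.count x : ℚ) = (M.map fun p => if p = x then (1 : ℚ) else 0).sum := by
        intro M x
        induction M using Multiset.induction_on with
        | empty => simp
        | cons p M ih =>
          rw [Multiset.count_cons, Multiset.map_cons, Multiset.sum_cons, ← ih, Nat.cast_add,
            add_comm]
          simp [eq_comm]
      rw [powerBasis_apply, convFunctional_powerSumPart, hcount]
      refine congrArg Multiset.sum (Multiset.map_congr rfl ?_)
      rintro ⟨a, b⟩ -
      simp only [← powerBasis_apply, Module.Basis.coord_apply, Module.Basis.repr_self,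
        Finsupp.single_apply, Prod.mk.injEq]
      by_cases h1 : a = s <;> by_cases h2 : b = t <;> simp [h1, h2]
    rw [← h, LinearMap.smul_apply, Module.Basis.coord_apply, Module.Basis.repr_self,
      Finsupp.single_apply, smul_eq_mul]
    split_ifs with hl
    · rw [hl, mul_one]
    · rw [mul_zero, Nat.cast_eq_zero, Multiset.count_eq_zero, Multiset.mem_antidiagonal]
      exact fun h => hl h.symm

/-- On degree n only x₀^n survives the evaluation; for n ≥ 1 its coefficient is the coordinate at
m_(n). -/
theorem zetaS_of_mem {n : ℕ} {f : Sym} (hf : f ∈ symGrading n) :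
    zetaS f = symCoeff (Finsupp.single 0 n) f := by
  change evalOne f = _
  refine finsum_eq_single _ n fun m hm => hf _ ?_
  rwa [Finsupp.degree_single]

theorem zetaS_powerSum (n : ℕ+) : zetaS (powerSum n) = 1 := by
  rw [powerSum, zetaS_of_mem (monoSym_mem _), symCoeff_monoSym, if_pos]
  simp [IntPart.parts, shape_single]

theorem zetaS_powerSumPart (l : IntPart) : zetaS (powerSumPart l) = 1 := by
  rw [powerSumPart, map_multiset_prod, Multiset.map_map]
  simp [zetaS_powerSum]

/-- The functional `ζ_S * ζ̄_S`. -/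
def zetaConvBar : Sym →ₗ[ℚ] ℚ :=
  convFunctional zetaS.toLinearMap (barFunctional symGrading zetaS.toLinearMap)

/-- Since ζ_S is 1 on every p_μ, a splitting (μ, ν) contributes only the sign (-1)^|ν|, which is a
product over the parts of ν. The sum over splittings is therefore the expansion of a product of
binomials. -/
theorem zetaConvBar_powerSumPart (l : IntPart) :
    zetaConvBar (powerSumPart l) = (l.map fun n : ℕ+ => (1 + (-1) ^ (n : ℕ) : ℚ)).prod := by
  rw [zetaConvBar, convFunctional_powerSumPart, Multiset.prod_map_add]
  refine congrArg Multiset.sum (Multiset.map_congr rfl fun p _ => ?_)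
  rw [barFunctional_of_mem _ _ (powerSumPart_mem p.2)]
  simp only [AlgHom.toLinearMap_apply, zetaS_powerSumPart, Multiset.map_const', Multiset.prod_replicate,
    one_pow, one_mul, mul_one]
  rw [IntPart.parts]
  induction p.2 using Multiset.induction_on with
  | empty => simp
  | cons n l ih => simp only [Multiset.map_cons, Multiset.sum_cons, Multiset.prod_cons, pow_add, ih]

theorem counit_of_mem {n : ℕ} (hn : n ≠ 0) {f : Sym} (hf : f ∈ symGrading n) :
    Coalgebra.counit (R := ℚ) f = 0 :=
  hf 0 (by simpa using hn.symm)

/-! ### The even subalgebra -/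

/-- An odd part n kills the coordinate, because in degree n the two functionals are opposite and
equal. Conversely, even partitions split into even partitions and have even size, so the sign in ζ̄
disappears. -/
theorem evenSubalgebra_eq :
    evenSubalgebra symGrading zetaS = Submodule.span ℚ (monoSym '' {l | l.IsEven}) := by
  refine le_antisymm ?_ ?_
  · obtain ⟨⟨hC, hζ⟩, -⟩ := isGreatest_agreeSub symGrading
      (barFunctional symGrading zetaS.toLinearMap) zetaS.toLinearMap
    intro f hf
    rw [← coe_monoBasis, mem_span_image_iff_coord]
    intro l hl
    have : ¬ l.IsEven := hl
    simp only [IntPart.IsEven, not_forall, Nat.not_even_iff_odd] at this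
    obtain ⟨n, hn, hodd⟩ := this
    obtain ⟨μ, rfl⟩ := Multiset.exists_cons_of_mem hn
    have hsplit := convFunctional_monoBasis_coord μ {n}
    rw [Multiset.add_comm, Multiset.singleton_add] at hsplit
    refine hC.coord_eq_zero one_ne_zero hsplit (fun g hg => ?_) f hf
    have hsz : IntPart.parts {n} = {(n : ℕ)} := by simp [IntPart.parts]
    have hd := coord_decompose symGrading monoBasis (d := fun l => l.parts.sum)
      (fun l => by rw [monoBasis_apply]; exact monoSym_mem l) (i := {n}) (n := n) (by simp [hsz]) g
    have hmem : (DirectSum.decompose symGrading g (n : ℕ) : Sym) ∈ symGrading n :=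
      SetLike.coe_mem _
    -- For the component of odd degree n, the coordinate c at m_(n) satisfies -c = c.
    have h1 := hζ _ (hC.homogeneous g hg n)
    rw [barFunctional_of_mem _ _ hmem, hodd.neg_one_pow, AlgHom.toLinearMap_apply,
      zetaS_of_mem hmem, ← monoBasis_coord (l := {n}) (by rw [shape_single _ _ n.ne_zero, hsz]),
      hd] at h1
    linarith
  · refine (isGreatest_agreeSub symGrading (barFunctional symGrading zetaS.toLinearMap)
      zetaS.toLinearMap).2 ⟨isGradedSubcoalgebra_span symGrading ?_ ?_, ?_⟩
    · rintro _ ⟨l, -, rfl⟩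
      exact ⟨_, monoSym_mem l⟩
    · rintro _ ⟨l, hl, rfl⟩
      rw [comul_monoSym]
      refine Submodule.sum_mem _ fun p hp => ?_
      rw [IntPart.mem_splittings] at hp
      refine tmul_mem_range (Submodule.subset_span ⟨p.1, fun n hn => hl n ?_, rfl⟩)
        (Submodule.subset_span ⟨p.2, fun n hn => hl n ?_, rfl⟩)
      · rw [← hp]; exact Multiset.mem_add.2 (Or.inl hn)
      · rw [← hp]; exact Multiset.mem_add.2 (Or.inr hn)
    · intro f hf
      induction hf using Submodule.span_induction with
      | mem x hx =>
        obtain ⟨l, hl, rfl⟩ := hx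
        have he : Even l.parts.sum := by
          refine even_iff_two_dvd.2 (Multiset.dvd_sum fun m hm => ?_)
          obtain ⟨n, hn, rfl⟩ := Multiset.mem_map.1 hm
          exact even_iff_two_dvd.1 (hl n hn)
        rw [barFunctional_of_mem _ _ (monoSym_mem l), he.neg_one_pow, one_mul]
      | zero => rw [map_zero, map_zero]
      | add x y _ _ hx hy => rw [map_add, map_add, hx, hy]
      | smul c x _ hx => rw [map_smul, map_smul, hx]

/-! ### The odd subalgebra -/

theorem isGradedSubcoalgebra_powerSum_odd :
    IsGradedSubcoalgebra symGrading (Submodule.span ℚ (powerSumPart '' {l | l.IsOdd})) := by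
  refine isGradedSubcoalgebra_span symGrading ?_ ?_
  · rintro _ ⟨l, -, rfl⟩
    exact ⟨_, powerSumPart_mem l⟩
  · rintro _ ⟨l, hl, rfl⟩
    rw [comul_powerSumPart]
    refine multiset_sum_mem _ fun x hx => ?_
    obtain ⟨p, hp, rfl⟩ := Multiset.mem_map.1 hx
    rw [Multiset.mem_antidiagonal] at hp
    refine tmul_mem_range (Submodule.subset_span ⟨p.1, fun n hn => hl n ?_, rfl⟩)
      (Submodule.subset_span ⟨p.2, fun n hn => hl n ?_, rfl⟩)
    · rw [← hp]; exact Multiset.mem_add.2 (Or.inl hn)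
    · rw [← hp]; exact Multiset.mem_add.2 (Or.inr hn)

/-- A graded subcoalgebra on which `ζ_S * ζ̄_S` is the counit lies in the odd subalgebra. -/
theorem le_oddSubalgebra {s : Set Sym}
    (hs : IsGradedSubcoalgebra symGrading (Submodule.span ℚ s))
    (h : ∀ f ∈ s, zetaConvBar f = Coalgebra.counit (R := ℚ) f) :
    Submodule.span ℚ s ≤ oddSubalgebra symGrading zetaS := by
  refine (isGreatest_agreeSub symGrading (barFunctional symGrading zetaS.toLinearMap)
    (convInverse zetaS)).2 ⟨hs, (eq_convInverse_iff hs.comul_mem zetaS _).2 fun f hf => ?_⟩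
  change zetaConvBar f = _
  induction hf using Submodule.span_induction with
  | mem x hx => exact h x hx
  | zero => rw [map_zero, map_zero]
  | add x y _ _ hx hy => rw [map_add, map_add, hx, hy]
  | smul c x _ hx => rw [map_smul, map_smul, hx]

theorem powerBasis_coord_eq_zero_of_mem {n : ℕ} {f : Sym} (hf : f ∈ symGrading n) {l : IntPart}
    (hl : l.parts.sum ≠ n) : powerBasis.coord l f = 0 := by
  have := coord_decompose symGrading powerBasis (d := fun l => l.parts.sum)
    (fun l => by rw [powerBasis_apply]; exact powerSumPart_mem l) (i := l) rfl f
  rw [← this, DirectSum.decompose_of_mem_ne _ hf (Ne.symm hl), map_zero]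

/-- By duality it suffices to treat l = (n) on the component f of degree n. Expand (ζ * ζ̄)(f) =
ε(f) = 0 in the p_λ: partitions with an odd part have weight 0, those with an even part below n have
coordinate 0 by induction, and only λ = (n), of weight 2, remains. -/
theorem powerBasis_coord_even_eq_zero {C : Submodule ℚ Sym}
    (hC : IsGradedSubcoalgebra symGrading C)
    (hζ : ∀ f ∈ C, zetaConvBar f = Coalgebra.counit (R := ℚ) f) {l : IntPart} {n : ℕ+} (hn : n ∈ l)
    (he : Even (n : ℕ)) : ∀ f ∈ C, powerBasis.coord l f = 0 := by
  induction n using PNat.strongInductionOn generalizing l with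
  | _ n ih =>
  obtain ⟨μ, rfl⟩ := Multiset.exists_cons_of_mem hn
  obtain ⟨c, hc, hsplit⟩ := convFunctional_powerBasis_coord μ {n}
  rw [Multiset.add_comm, Multiset.singleton_add] at hsplit
  refine hC.coord_eq_zero hc hsplit fun g hg => ?_
  have hsz : IntPart.parts {n} = {(n : ℕ)} := by simp [IntPart.parts]
  have hd := coord_decompose symGrading powerBasis (d := fun l => l.parts.sum)
    (fun l => by rw [powerBasis_apply]; exact powerSumPart_mem l) (i := {n}) (n := n) (by simp [hsz]) g
  have hmem : (DirectSum.decompose symGrading g (n : ℕ) : Sym) ∈ symGrading n := SetLike.coe_mem _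
  set f : Sym := (DirectSum.decompose symGrading g (n : ℕ) : Sym) with hf
  have hfC : f ∈ C := hC.homogeneous g hg n
  have h1 := hζ f hfC
  rw [counit_of_mem n.ne_zero hmem, ← powerBasis.linearCombination_repr f,
    Finsupp.linearCombination_apply, Finsupp.sum, map_sum] at h1
  rw [← hd]
  by_contra h0
  rw [Finset.sum_eq_single_of_mem {n} (Finsupp.mem_support_iff.2 h0), map_smul, powerBasis_apply,
    zetaConvBar_powerSumPart, Multiset.map_singleton, Multiset.prod_singleton, he.neg_one_pow] at h1
  · refine h0 ?_
    rw [Module.Basis.coord_apply]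
    rw [smul_eq_mul] at h1
    linarith
  · intro l hl hne
    rw [map_smul, powerBasis_apply, zetaConvBar_powerSumPart]
    by_cases hodd : ∃ m ∈ l, Odd (m : ℕ)
    · obtain ⟨m, hm, hmo⟩ := hodd
      rw [Multiset.prod_eq_zero, smul_zero]
      exact Multiset.mem_map.2 ⟨m, hm, by rw [hmo.neg_one_pow]; norm_num⟩
    · push Not at hodd
      have hrepr : powerBasis.coord l f ≠ 0 := Finsupp.mem_support_iff.1 hl
      have hsum : l.parts.sum = n := by
        by_contra hsum
        exact hrepr (powerBasis_coord_eq_zero_of_mem hmem hsum)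
      exfalso
      -- All parts of l are now even and at most n. A part below n is excluded by induction, so l
      -- consists of copies of n, and its size n leaves a single copy.
      have hall : ∀ m ∈ l, m = n := by
        intro m hm
        have hle : (m : ℕ) ≤ n := by
          rw [← hsum]
          exact Multiset.single_le_sum (fun _ _ => Nat.zero_le _) _ (Multiset.mem_map_of_mem _ hm)
        by_contra hmn
        have hlt : m < n := lt_of_le_of_ne hle hmn
        exact hrepr (ih m hlt hm (Nat.not_odd_iff_even.1 (hodd m hm)) f hfC)
      rw [Multiset.eq_replicate_of_mem hall] at hsum hne
      rw [IntPart.parts, Multiset.map_replicate, Multiset.sum_replicate, smul_eq_mul] at hsum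
      have hcard : Multiset.card l = 1 := by
        have := n.pos
        exact Nat.eq_of_mul_eq_mul_right this (by rw [hsum, one_mul])
      rw [hcard] at hne
      exact hne (Multiset.replicate_one _)

/-- An odd p_λ has a factor 1 + (-1) = 0 in (ζ * ζ̄)(p_λ) unless λ is empty, which is the value of
the counit. -/
theorem oddSubalgebra_eq :
    oddSubalgebra symGrading zetaS = Submodule.span ℚ (powerSumPart '' {l | l.IsOdd}) := by
  refine le_antisymm ?_ (le_oddSubalgebra isGradedSubcoalgebra_powerSum_odd ?_)
  · obtain ⟨⟨hC, hζ⟩, -⟩ := isGreatest_agreeSub symGrading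
      (barFunctional symGrading zetaS.toLinearMap) (convInverse zetaS)
    intro f hf
    rw [← coe_powerBasis, mem_span_image_iff_coord]
    intro l hl
    have : ¬ l.IsOdd := hl
    simp only [IntPart.IsOdd, not_forall, Nat.not_odd_iff_even] at this
    obtain ⟨n, hn, he⟩ := this
    exact powerBasis_coord_even_eq_zero hC ((eq_convInverse_iff hC.comul_mem zetaS _).1 hζ)
      hn he f hf
  · rintro _ ⟨l, hl, rfl⟩
    rw [zetaConvBar_powerSumPart]
    induction l using Multiset.induction_on with
    | empty =>
      rw [powerSumPart_zero, Bialgebra.counit_one]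
      simp
    | cons n l _ =>
      rw [counit_of_mem _ (powerSumPart_mem _), Multiset.map_cons, Multiset.prod_cons,
        (hl n (Multiset.mem_cons_self _ _)).neg_one_pow]
      · simp
      · rw [parts_cons, Multiset.sum_cons]
        have := n.pos
        omega

/-! ### Schur's `q`-functions and odd power sums -/

theorem elemSym_mem (n : ℕ) : elemSym n ∈ symGrading n := by
  have := monoSym_mem (Multiset.replicate n 1)
  simpa [IntPart.parts, elemSym] using this

theorem completeSym_mem (n : ℕ) : completeSym n ∈ symGrading n := fun _ ha => if_neg ha

theorem schurq_mem (n : ℕ) : schurq n ∈ symGrading n := by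
  refine Submodule.sum_mem _ fun i hi => ?_
  rw [Finset.mem_range] at hi
  have := SetLike.mul_mem_graded (elemSym_mem i) (completeSym_mem (n - i))
  rwa [Nat.add_sub_cancel' (by omega)] at this

open scoped Classical in
theorem symCoeff_elemSym (b : ℕ →₀ ℕ) (i : ℕ) :
    symCoeff b (elemSym i) = if (∀ j, b j ≤ 1) ∧ b.degree = i then 1 else 0 := by
  rw [elemSym, symCoeff_monoSym]
  refine if_congr ?_ rfl rfl
  have hp : IntPart.parts (Multiset.replicate i 1) = Multiset.replicate i 1 := by
    simp [IntPart.parts]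
  rw [hp]
  constructor
  · intro h
    refine ⟨fun j => ?_, ?_⟩
    · by_contra! hj
      have hmem : b j ∈ shape b :=
        Multiset.mem_map_of_mem _ (show j ∈ b.support by rw [Finsupp.mem_support_iff]; omega)
      rw [h] at hmem
      have := Multiset.eq_of_mem_replicate hmem
      omega
    · rw [← sum_shape, h]; simp
  · rintro ⟨h1, h2⟩
    have hall : ∀ m ∈ shape b, m = 1 := by
      intro m hm
      obtain ⟨j, hj, rfl⟩ := Multiset.mem_map.1 hm
      have : b j ≠ 0 := Finsupp.mem_support_iff.1 hj
      have := h1 j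
      omega
    have hr := Multiset.eq_replicate_of_mem hall
    rw [hr, ← h2, ← sum_shape, hr]
    simp

open scoped Classical in
-- A squarefree divisor of x^a is the product of the variables in a subset of the support.
theorem card_antidiagonal_le_one (a : ℕ →₀ ℕ) :
    ((Finset.HasAntidiagonal.antidiagonal a).filter fun p => ∀ j, p.1 j ≤ 1).card =
      2 ^ a.support.card := by
  rw [← Finset.card_powerset]
  refine Finset.card_nbij' (fun p => p.1.support)
    (fun S => (Finsupp.indicator S fun _ _ => 1, a - Finsupp.indicator S fun _ _ => 1)) ?_ ?_ ?_ ?_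
  · rintro ⟨p, q⟩ hp
    rw [Finset.mem_coe, Finset.mem_filter, Finset.HasAntidiagonal.mem_antidiagonal] at hp
    rw [Finset.mem_coe, Finset.mem_powerset, ← hp.1]
    intro j hj
    simp only [Finsupp.mem_support_iff, Finsupp.add_apply] at hj ⊢
    omega
  · intro S hS
    rw [Finset.mem_coe, Finset.mem_powerset] at hS
    rw [Finset.mem_coe, Finset.mem_filter, Finset.HasAntidiagonal.mem_antidiagonal]
    refine ⟨add_tsub_cancel_of_le fun j => ?_, fun j => ?_⟩
    · rw [Finsupp.indicator_apply]
      split_ifs with h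
      · exact Nat.one_le_iff_ne_zero.2 (Finsupp.mem_support_iff.1 (hS h))
      · exact Nat.zero_le _
    · simp only [Finsupp.indicator_apply]
      split_ifs <;> simp
  · rintro ⟨p, q⟩ hp
    rw [Finset.mem_coe, Finset.mem_filter, Finset.HasAntidiagonal.mem_antidiagonal] at hp
    obtain ⟨rfl, hp⟩ := hp
    have h : (Finsupp.indicator p.support fun _ _ => 1) = p := by
      ext j
      rw [Finsupp.indicator_apply]
      split_ifs with hj
      · have := Finsupp.mem_support_iff.1 hj
        have := hp j
        simp only at this
        omega
      · exact (Finsupp.notMem_support_iff.1 hj).symm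
    simp [h]
  · intro S _
    ext j
    simp [Finsupp.indicator_apply]

open scoped Classical in
-- The e_i supply the squarefree monomials and the h_(n-i) all monomials, each once. The coefficient
-- thus counts the squarefree divisors of x^a.
theorem symCoeff_schurq {a : ℕ →₀ ℕ} {n : ℕ} (ha : a.degree = n) :
    symCoeff a (schurq n) = 2 ^ a.support.card := by
  have h1 : ∀ i, symCoeff a (elemSym i * completeSym (n - i)) =
      ∑ p ∈ Finset.HasAntidiagonal.antidiagonal a,
        if (∀ j, p.1 j ≤ 1) ∧ p.1.degree = i ∧ p.2.degree = n - i then (1 : ℚ) else 0 := by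
    intro i
    change MvPowerSeries.coeff a ((elemSym i).1 * (completeSym (n - i)).1) = _
    rw [MvPowerSeries.coeff_mul]
    refine Finset.sum_congr rfl fun p _ => ?_
    have he : MvPowerSeries.coeff p.1 (elemSym i).1 = _ := symCoeff_elemSym p.1 i
    have hh : MvPowerSeries.coeff p.2 (completeSym (n - i)).1 =
      if p.2.degree = n - i then 1 else 0 := rfl
    rw [he, hh]
    by_cases h1 : ∀ j, p.1 j ≤ 1 <;> by_cases h2 : p.1.degree = i <;>
      by_cases h3 : p.2.degree = n - i <;> simp [h1, h2, h3]
  rw [schurq, map_sum]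
  simp only [h1]
  rw [Finset.sum_comm]
  -- For a given factorization of x^a, the index i is forced to be the degree of the first factor.
  have h2 : ∀ p ∈ Finset.HasAntidiagonal.antidiagonal a, (∑ i ∈ Finset.range (n + 1),
      if (∀ j, p.1 j ≤ 1) ∧ p.1.degree = i ∧ p.2.degree = n - i then (1 : ℚ) else 0) =
        if ∀ j, p.1 j ≤ 1 then 1 else 0 := by
    intro p hp
    rw [Finset.HasAntidiagonal.mem_antidiagonal] at hp
    have hdeg : p.1.degree + p.2.degree = n := by rw [← map_add, hp, ha]
    rw [Finset.sum_eq_single_of_mem p.1.degree (Finset.mem_range.2 (by omega))]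
    · refine if_congr ⟨fun h => h.1, fun h => ⟨h, rfl, by omega⟩⟩ rfl rfl
    · intro i _ hi
      exact if_neg fun h => hi h.2.1.symm
  rw [Finset.sum_congr rfl h2, Finset.sum_boole, card_antidiagonal_le_one]
  norm_num

/-- The pairs {r, r + 1} with r even and r < n tile {0, …, n - 1} if n is even and {0, …, n} if n is
odd. The sum counts the tiled integers below m. -/
theorem sum_even_weights (n m : ℕ) :
    (∑ r ∈ Finset.range n, if Even r then
      ((if r < m then 1 else 0) + (if r + 1 < m then 1 else 0) : ℕ) else 0) =
      if Even n then min m n else min m (n + 1) := by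
  induction n with
  | zero => simp
  | succ n ih =>
    rw [Finset.sum_range_succ, ih]
    by_cases h : Even n
    · have : ¬ Even (n + 1) := by rwa [Nat.even_add_one, not_not]
      rw [if_pos h, if_pos h, if_neg this]
      split_ifs <;> omega
    · have : Even (n + 1) := Nat.even_add_one.2 h
      rw [if_neg h, if_neg h, if_pos this, add_zero]

/-- The Newton identity `n q_n = 2 ∑_{r odd} p_r q_{n-r}`. -/
theorem schurq_newton (n : ℕ) : (n : ℚ) • schurq n =
    (2 : ℚ) • ∑ r ∈ Finset.range n with Even r, powerSum r.succPNat * schurq (n - (r + 1)) := by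
  refine Sym_ext fun a => ?_
  by_cases ha : a.degree = n
  · rw [map_smul, map_smul, map_sum, symCoeff_schurq ha, smul_eq_mul, smul_eq_mul, Finset.mul_sum]
    -- Let k be the size of the support of a. Removing x_i^(r+1) keeps the support if r + 1 < a_i,
    -- giving 2 · 2^k, and loses one variable if r + 1 = a_i, giving 2 · 2^(k-1). The two indicators
    -- record both cases.
    have h1 : ∀ r ∈ (Finset.range n).filter (fun r => Even r),
        2 * symCoeff a (powerSum r.succPNat * schurq (n - (r + 1))) =
          ∑ i ∈ a.support, 2 ^ a.support.card *
            ((if r < a i then 1 else 0) + (if r + 1 < a i then 1 else 0) : ℚ) := by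
      intro r _
      rw [symCoeff_powerSum_mul, Nat.succPNat_coe, Finset.sum_filter, Finset.mul_sum]
      refine Finset.sum_congr rfl fun i hi => ?_
      by_cases hlt : r < a i
      · have hle : Finsupp.single i (r + 1) ≤ a := Finsupp.single_le_iff.2 hlt
        have hdeg : (a - Finsupp.single i (r + 1)).degree = n - (r + 1) := by
          have := congrArg Finsupp.degree (add_tsub_cancel_of_le hle)
          rw [map_add, Finsupp.degree_single] at this
          omega
        rw [if_pos (Nat.succ_le_of_lt hlt), Nat.succ_eq_add_one, symCoeff_schurq hdeg, if_pos hlt]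
        split_ifs with hlt2
        · rw [support_sub_single hlt2]
          ring
        · have he : r + 1 = a i := by omega
          have hs := congrArg Multiset.card (shape_eq_cons hi)
          rw [Multiset.card_cons, card_shape, card_shape] at hs
          rw [he, hs, pow_succ]
          ring
      · rw [if_neg (show ¬ r.succ ≤ a i from hlt), if_neg hlt, if_neg (by omega)]
        simp
    rw [Finset.sum_congr rfl h1, Finset.sum_comm]
    have h2 : ∀ i ∈ a.support, (∑ r ∈ Finset.range n with Even r, 2 ^ a.support.card *
        ((if r < a i then 1 else 0) + (if r + 1 < a i then 1 else 0) : ℚ)) =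
          2 ^ a.support.card * (a i : ℚ) := by
      intro i hi
      have hle : a i ≤ n := by
        rw [← ha]
        exact Finsupp.le_degree i a
      have h3 := sum_even_weights n (a i)
      -- Since a_i ≤ n, the truncation is harmless and the weights sum to a_i; summing over i then
      -- gives the degree n.
      have h4 : (if Even n then min (a i) n else min (a i) (n + 1)) = a i := by
        split_ifs <;> omega
      rw [h4] at h3
      rw [← Finset.mul_sum, Finset.sum_filter]
      congr 1
      have h5 := congrArg (Nat.cast : ℕ → ℚ) h3
      push_cast at h5
      exact h5
    rw [Finset.sum_congr rfl h2, ← Finset.mul_sum, mul_comm, ← ha]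
    congr 1
    rw [Finsupp.degree_apply]
    push_cast
    rfl
  · have h : ∑ r ∈ Finset.range n with Even r, powerSum r.succPNat * schurq (n - (r + 1)) ∈
        symGrading n := by
      refine Submodule.sum_mem _ fun r hr => ?_
      rw [Finset.mem_filter, Finset.mem_range] at hr
      have hp : powerSum r.succPNat ∈ symGrading (r + 1) := by
        simpa [IntPart.parts, powerSum] using monoSym_mem {r.succPNat}
      have := SetLike.mul_mem_graded hp (schurq_mem (n - (r + 1)))
      rwa [Nat.add_sub_cancel' (by omega)] at this
    rw [Submodule.smul_mem _ _ (schurq_mem n) a ha, Submodule.smul_mem _ _ h a ha]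

theorem schurq_zero : schurq 0 = 1 := by
  have h1 : elemSym 0 = 1 := by rw [elemSym, Multiset.replicate_zero, monoSym_zero]
  have h2 : completeSym 0 = 1 := by
    refine Sym_ext fun a => ?_
    rw [← monoSym_zero, symCoeff_monoSym]
    change (if a.degree = 0 then (1 : ℚ) else 0) = _
    refine if_congr ?_ rfl rfl
    rw [Finsupp.degree_eq_zero_iff]
    constructor
    · rintro rfl; simp [shape, IntPart.parts]
    · intro h
      rw [← Finsupp.support_eq_empty, ← Finset.card_eq_zero, ← card_shape, h]
      rfl
  simp [schurq, h1, h2]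

/-- Newton's identity divided by n expresses q_n by odd power sums and earlier q's. -/
theorem schurq_mem_adjoin (n : ℕ) :
    schurq n ∈ Algebra.adjoin ℚ {f : Sym | ∃ m : ℕ+, Odd (m : ℕ) ∧ f = powerSum m} := by
  induction n using Nat.strong_induction_on with
  | _ n ih =>
  rcases Nat.eq_zero_or_pos n with rfl | hn
  · rw [schurq_zero]; exact one_mem _
  · have hn0 : (n : ℚ) ≠ 0 := by exact_mod_cast hn.ne'
    have h : schurq n = (n : ℚ)⁻¹ • (n : ℚ) • schurq n := by rw [inv_smul_smul₀ hn0]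
    rw [h, schurq_newton]
    refine Subalgebra.smul_mem _ (Subalgebra.smul_mem _ (Subalgebra.sum_mem _ fun r hr => ?_) _) _
    rw [Finset.mem_filter, Finset.mem_range] at hr
    refine mul_mem (Algebra.subset_adjoin ⟨_, ?_, rfl⟩) (ih _ (by omega))
    rw [Nat.succPNat_coe]
    exact hr.2.add_one

theorem powerSum_mem_schurQAlgebra (m : ℕ+) (hm : Odd (m : ℕ)) : powerSum m ∈ schurQAlgebra := by
  induction m using PNat.strongInductionOn with
  | _ m ih =>
  have hq : ∀ n, schurq n ∈ schurQAlgebra := by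
    intro n
    rcases Nat.eq_zero_or_pos n with rfl | hn
    · rw [schurq_zero]; exact one_mem _
    · exact Algebra.subset_adjoin ⟨n, hn, rfl⟩
  obtain ⟨r, rfl⟩ : ∃ r : ℕ, m = r.succPNat := ⟨m.natPred, (PNat.succPNat_natPred m).symm⟩
  rw [Nat.succPNat_coe] at hm
  have hr : Even r := by
    rw [Nat.succ_eq_add_one, Nat.odd_add_one, Nat.not_odd_iff_even] at hm
    exact hm
  have hN := schurq_newton (r + 1)
  -- The top summand is p_(r+1) q_0 = p_(r+1), so Newton's identity can be solved for it; the other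
  -- summands contain smaller odd power sums.
  rw [Finset.range_add_one, Finset.filter_insert, if_pos hr, Finset.sum_insert (by simp),
    Nat.sub_self, schurq_zero, mul_one] at hN
  have h : powerSum r.succPNat = (2 : ℚ)⁻¹ • (((r + 1 : ℕ) : ℚ) • schurq (r + 1)) -
      ∑ s ∈ Finset.range r with Even s, powerSum s.succPNat * schurq (r + 1 - (s + 1)) := by
    rw [hN, inv_smul_smul₀ (by norm_num), add_sub_cancel_right]
  rw [h]
  refine sub_mem (Subalgebra.smul_mem _ (Subalgebra.smul_mem _ (hq _) _) _)
    (Subalgebra.sum_mem _ fun s hs => mul_mem (ih _ ?_ ?_) (hq _))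
  · rw [Finset.mem_filter, Finset.mem_range] at hs
    exact Nat.succPNat_lt_succPNat.2 hs.1
  · rw [Finset.mem_filter] at hs
    rw [Nat.succPNat_coe]
    exact hs.2.add_one

theorem span_powerSumPart_odd :
    Submodule.span ℚ (powerSumPart '' {l | l.IsOdd}) = Subalgebra.toSubmodule schurQAlgebra := by
  refine le_antisymm (Submodule.span_le.2 ?_) ?_
  · rintro _ ⟨l, hl, rfl⟩
    have h : powerSumPart l ∈ schurQAlgebra := by
      refine multiset_prod_mem _ fun f hf => ?_
      obtain ⟨m, hm, rfl⟩ := Multiset.mem_map.1 hf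
      exact powerSum_mem_schurQAlgebra m (hl m hm)
    exact h
  · have hle : schurQAlgebra ≤
        Algebra.adjoin ℚ {f : Sym | ∃ m : ℕ+, Odd (m : ℕ) ∧ f = powerSum m} := by
      refine Algebra.adjoin_le ?_
      rintro _ ⟨n, -, rfl⟩
      exact schurq_mem_adjoin n
    refine le_trans (Subalgebra.toSubmodule.monotone hle) ?_
    rw [Algebra.adjoin_eq_span]
    refine Submodule.span_mono fun f hf => ?_
    induction hf using Submonoid.closure_induction with
    | mem x hx =>
      obtain ⟨m, hm, rfl⟩ := hx
      exact ⟨{m}, fun n hn => by rwa [Multiset.mem_singleton.1 hn], powerSumPart_singleton m⟩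
    | one => exact ⟨0, fun n hn => absurd hn (Multiset.notMem_zero n), powerSumPart_zero⟩
    | mul x y _ _ hx hy =>
      obtain ⟨l, hl, rfl⟩ := hx
      obtain ⟨μ, hμ, rfl⟩ := hy
      refine ⟨l + μ, fun n hn => ?_, ?_⟩
      · rcases Multiset.mem_add.1 hn with h | h
        · exact hl n h
        · exact hμ n h
      · rw [powerSumPart, Multiset.map_add, Multiset.prod_add]
        rfl

/-! ### Refinement of compositions -/

theorem IntComp.size_append (α β : IntComp) :
    IntComp.size (α ++ β) = IntComp.size α + IntComp.size β := by
  simp [IntComp.size]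

theorem IntComp.size_cons (n : ℕ+) (α : IntComp) :
    IntComp.size (n :: α) = n + IntComp.size α := by
  simp [IntComp.size]

theorem IntComp.size_nil : IntComp.size [] = 0 := rfl

theorem IntComp.size_eq_zero {α : IntComp} (h : IntComp.size α = 0) : α = [] := by
  cases α with
  | nil => rfl
  | cons n α =>
    rw [IntComp.size_cons] at h
    have := n.pos
    omega

/-- Two factorizations of a composition are nested, as determined by the sizes. -/
theorem IntComp.append_eq_append {α α' β β' : IntComp} (h : α ++ α' = β ++ β')
    (hs : IntComp.size α ≤ IntComp.size β) : ∃ γ, β = α ++ γ ∧ α' = γ ++ β' := by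
  rcases List.append_eq_append_iff.1 h with ⟨γ, h1, h2⟩ | ⟨γ, h1, h2⟩
  · exact ⟨γ, h1, h2⟩
  · have : γ = [] := by
      apply IntComp.size_eq_zero
      rw [h1, IntComp.size_append] at hs
      omega
    subst this
    exact ⟨[], by simpa using h1.symm, by simpa using h2.symm⟩

/-- The parts are positive, so the place of a cut is determined by the size of the left piece. -/
theorem IntComp.append_inj {α α' β β' : IntComp} (h : α ++ α' = β ++ β')
    (hs : IntComp.size α = IntComp.size β) : α = β ∧ α' = β' := by
  obtain ⟨γ, h1, h2⟩ := IntComp.append_eq_append h hs.le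
  have : γ = [] := by
    apply IntComp.size_eq_zero
    rw [h1, IntComp.size_append] at hs
    omega
  subst this
  exact ⟨by simpa using h1.symm, by simpa using h2⟩

/-- `α` is obtained from the composition `e` by replacing each part by a composition of it. -/
def IntComp.Refines : IntComp → IntComp → Prop
  | [], α => α = []
  | n :: e, α => ∃ α₁ α₂, α = α₁ ++ α₂ ∧ IntComp.size α₁ = n ∧ IntComp.Refines e α₂

theorem IntComp.Refines.size_eq {e α : IntComp} (h : IntComp.Refines e α) :
    IntComp.size α = IntComp.size e := by
  induction e generalizing α with
  | nil => rw [show α = [] from h]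
  | cons n e ih =>
    obtain ⟨α₁, α₂, rfl, h1, h2⟩ := h
    rw [IntComp.size_append, IntComp.size_cons, h1, ih h2]

theorem IntComp.refines_self (e : IntComp) : IntComp.Refines e e := by
  induction e with
  | nil => rfl
  | cons n e ih => exact ⟨[n], e, rfl, by simp [IntComp.size], ih⟩

theorem IntComp.refines_singleton (n : ℕ+) (α : IntComp) :
    IntComp.Refines [n] α ↔ IntComp.size α = n := by
  constructor
  · intro h
    rw [h.size_eq]
    simp [IntComp.size]
  · intro h
    exact ⟨α, [], by simp, h, rfl⟩

/-- Each part of e is replaced by a block of positive size, hence by at least one part; equal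
lengths force every block to be a single part. This gives the triangularity of the η_λ. -/
theorem IntComp.Refines.length_le {e α : IntComp} (h : IntComp.Refines e α) :
    e.length ≤ α.length ∧ (e.length = α.length → e = α) := by
  induction e generalizing α with
  | nil => rw [show α = [] from h]; simp
  | cons n e ih =>
    obtain ⟨α₁, α₂, rfl, h1, h2⟩ := h
    obtain ⟨h3, h4⟩ := ih h2
    cases α₁ with
    | nil =>
      have := n.pos
      rw [IntComp.size_nil] at h1
      omega
    | cons m α₁ =>
      simp only [List.cons_append, List.length_cons, List.length_append]
      refine ⟨by omega, fun hl => ?_⟩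
      have h5 : α₁ = [] := List.length_eq_zero_iff.1 (by omega)
      subst h5
      rw [h4 (by simpa using hl)]
      have : m = n := PNat.eq (by simpa [IntComp.size] using h1)
      rw [this]
      rfl

/-- `α` can be cut at the partial sum `s`. -/
def IntComp.CutAt (α : IntComp) (s : ℕ) : Prop := ∃ α₁ α₂, α = α₁ ++ α₂ ∧ IntComp.size α₁ = s

theorem IntComp.mem_partialSums {α : IntComp} {s : ℕ} :
    s ∈ IntComp.partialSums α ↔ IntComp.CutAt α s ∧ s ≠ 0 ∧ s ≠ IntComp.size α := by
  rw [IntComp.partialSums, Finset.mem_image]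
  constructor
  · rintro ⟨i, hi, rfl⟩
    rw [Finset.mem_Ico] at hi
    refine ⟨⟨α.take i, α.drop i, (List.take_append_drop i α).symm, rfl⟩, fun h => ?_, fun h => ?_⟩
    · have := congrArg List.length (IntComp.size_eq_zero h)
      rw [List.length_take, List.length_nil] at this
      omega
    · have h1 := congrArg IntComp.size (List.take_append_drop i α)
      rw [IntComp.size_append] at h1
      have := congrArg List.length (IntComp.size_eq_zero (α := α.drop i) (by omega))
      rw [List.length_drop, List.length_nil] at this
      omega
  · rintro ⟨⟨α₁, α₂, rfl, rfl⟩, h0, h1⟩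
    refine ⟨α₁.length, ?_, by rw [List.take_left]⟩
    rw [Finset.mem_Ico, List.length_append]
    constructor
    · by_contra h
      have : α₁ = [] := List.length_eq_zero_iff.1 (by omega)
      exact h0 (by rw [this]; rfl)
    · by_contra h
      have : α₂ = [] := List.length_eq_zero_iff.1 (by omega)
      exact h1 (by rw [this, List.append_nil])

theorem IntComp.cutAt_zero (α : IntComp) : IntComp.CutAt α 0 := ⟨[], α, rfl, rfl⟩

theorem IntComp.cutAt_size (α : IntComp) : IntComp.CutAt α (IntComp.size α) :=
  ⟨α, [], (List.append_nil α).symm, rfl⟩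

/-- Bridge between the recursive description by blocks, suited to induction, and the description by
partial sums that defines `IntComp.coarsenings`. -/
theorem IntComp.refines_iff_cutAt (e α : IntComp) : IntComp.Refines e α ↔
    IntComp.size e = IntComp.size α ∧ ∀ s, IntComp.CutAt e s → IntComp.CutAt α s := by
  induction e generalizing α with
  | nil =>
    constructor
    · intro h
      rw [show α = [] from h]
      exact ⟨rfl, fun _ h => h⟩
    · rintro ⟨h, -⟩
      exact IntComp.size_eq_zero h.symm
  | cons n e ih =>
    constructor
    · intro h
      refine ⟨h.size_eq.symm, ?_⟩
      obtain ⟨α₁, α₂, rfl, h1, h2⟩ := h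
      rintro s ⟨e₁, e₂, he, rfl⟩
      cases e₁ with
      | nil => exact IntComp.cutAt_zero _
      | cons m e₁ =>
        rw [List.cons_append, List.cons.injEq] at he
        obtain ⟨rfl, rfl⟩ := he
        obtain ⟨β₁, β₂, rfl, hβ⟩ := ((ih α₂).1 h2).2 (IntComp.size e₁) ⟨e₁, e₂, rfl, rfl⟩
        exact ⟨α₁ ++ β₁, β₂, (List.append_assoc _ _ _).symm,
          by rw [IntComp.size_append, IntComp.size_cons, h1, hβ]⟩
    · rintro ⟨hs, hcut⟩
      obtain ⟨α₁, α₂, rfl, h1⟩ := hcut n ⟨[n], e, rfl, by simp [IntComp.size]⟩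
      rw [IntComp.size_cons, IntComp.size_append] at hs
      refine ⟨α₁, α₂, rfl, h1, (ih α₂).2 ⟨by omega, ?_⟩⟩
      rintro s ⟨e₁, e₂, rfl, rfl⟩
      -- A cut of the tail at s is a cut of the whole at n + s. It lies to the right of the cut at
      -- n, so it comes from a cut of `α₂`.
      obtain ⟨β₁, β₂, h, hβ⟩ := hcut (n + IntComp.size e₁)
        ⟨n :: e₁, e₂, rfl, IntComp.size_cons _ _⟩
      obtain ⟨γ, rfl, h3⟩ := IntComp.append_eq_append h (by omega)
      rw [IntComp.size_append] at hβ
      exact ⟨γ, β₂, h3, by omega⟩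

theorem IntComp.mem_coarsenings {e α : IntComp} :
    e ∈ IntComp.coarsenings α ↔ IntComp.Refines e α := by
  rw [IntComp.coarsenings, Set.Finite.mem_toFinset, Set.mem_ofPred_eq, IntComp.refines_iff_cutAt]
  -- The two definitions differ only at the end points 0 and |α|, where every composition can be
  -- cut.
  refine and_congr_right fun hs => ⟨fun h s hc => ?_, fun h s hc => ?_⟩
  · by_cases h0 : s = 0
    · rw [h0]; exact IntComp.cutAt_zero α
    by_cases h1 : s = IntComp.size e
    · rw [h1, hs]; exact IntComp.cutAt_size α
    exact (IntComp.mem_partialSums.1 (h (IntComp.mem_partialSums.2 ⟨hc, h0, h1⟩))).1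
  · rw [IntComp.mem_partialSums] at hc ⊢
    exact ⟨h s hc.1, hc.2.1, hs ▸ hc.2.2⟩

theorem IntComp.finite_refinements (e : IntComp) : {α | IntComp.Refines e α}.Finite :=
  (IntComp.finite_size (IntComp.size e)).subset fun _ h => h.size_eq

/-- The finite set of refinements of a composition. -/
def IntComp.refinements (e : IntComp) : Finset IntComp := (IntComp.finite_refinements e).toFinset

theorem IntComp.mem_refinements {e α : IntComp} :
    α ∈ IntComp.refinements e ↔ IntComp.Refines e α := by
  rw [IntComp.refinements, Set.Finite.mem_toFinset, Set.mem_ofPred_eq]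

/-- The generating function of the refinements of `e`, by their parts. -/
def refineGen (e : IntComp) : AddMonoidAlgebra ℚ IntPart :=
  ∑ α ∈ IntComp.refinements e, AddMonoidAlgebra.single ((α : Multiset ℕ+) : IntPart) 1

theorem refineGen_nil : refineGen [] = 1 := by
  have : IntComp.refinements [] = {[]} := by
    ext α
    rw [IntComp.mem_refinements, Finset.mem_singleton]
    exact Iff.rfl
  rw [refineGen, this, Finset.sum_singleton]
  rfl

/-- A refinement of n :: e splits uniquely into a composition of n and a refinement of e, and
concatenation becomes multiplication in the monoid algebra. -/
theorem refineGen_cons (n : ℕ+) (e : IntComp) :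
    refineGen (n :: e) = refineGen [n] * refineGen e := by
  rw [refineGen, refineGen, refineGen, Finset.sum_mul_sum, ← Finset.sum_product']
  symm
  refine Finset.sum_nbij (fun p => p.1 ++ p.2) ?_ ?_ ?_ ?_
  · rintro ⟨α, β⟩ h
    rw [Finset.mem_product, IntComp.mem_refinements, IntComp.mem_refinements,
      IntComp.refines_singleton] at h
    rw [IntComp.mem_refinements]
    exact ⟨α, β, rfl, h.1, h.2⟩
  · rintro ⟨α, β⟩ h ⟨α', β'⟩ h' heq
    rw [Finset.mem_coe, Finset.mem_product, IntComp.mem_refinements, IntComp.mem_refinements,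
      IntComp.refines_singleton] at h h'
    obtain ⟨h1, h2⟩ := IntComp.append_inj heq (h.1.trans h'.1.symm)
    exact Prod.ext h1 h2
  · intro α h
    rw [Finset.mem_coe, IntComp.mem_refinements] at h
    obtain ⟨α₁, α₂, rfl, h1, h2⟩ := h
    refine ⟨(α₁, α₂), ?_, rfl⟩
    rw [Finset.mem_coe, Finset.mem_product, IntComp.mem_refinements, IntComp.mem_refinements,
      IntComp.refines_singleton]
    exact ⟨h1, h2⟩
  · rintro ⟨α, β⟩ _
    rw [AddMonoidAlgebra.single_mul_single, one_mul]
    rfl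

theorem mem_lists_toFinset {l : IntPart} {α : IntComp} :
    α ∈ l.lists.toFinset ↔ ((α : Multiset ℕ+) : IntPart) = l := by
  rw [Multiset.mem_toFinset, Multiset.mem_lists_iff]
  exact eq_comm

open scoped Classical in
theorem coeff_refineGen (e : IntComp) (l : IntPart) :
    (refineGen e).coeff l = ∑ α ∈ l.lists.toFinset, if IntComp.Refines e α then 1 else 0 := by
  rw [refineGen, AddMonoidAlgebra.coeff_sum, Finsupp.finsetSum_apply, ← Finset.sum_filter]
  simp only [AddMonoidAlgebra.coeff_single, Finsupp.single_apply]
  rw [← Finset.sum_filter]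
  refine Finset.sum_congr ?_ fun _ _ => rfl
  ext α
  rw [Finset.mem_filter, Finset.mem_filter, IntComp.mem_refinements, mem_lists_toFinset, and_comm]

/-! ### The functions `η_λ` -/

/-- The generating function, in the variables `λ`, of the coefficients of `m_μ` in `η_λ`. -/
def etaGen (μ : IntPart) : AddMonoidAlgebra ℚ IntPart :=
  (μ.map fun n => (2 : ℚ) • refineGen [n]).prod

/-- The left side is a product in a commutative algebra. Hence the number of refinements of e with
given parts does not depend on the order of the parts of e, and this makes η_λ symmetric. -/
theorem etaGen_coe (e : IntComp) :
    etaGen ((e : Multiset ℕ+) : IntPart) = (2 : ℚ) ^ e.length • refineGen e := by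
  induction e with
  | nil => rw [refineGen_nil]; simp [etaGen]
  | cons n e ih =>
    have h : etaGen ((n :: e : List ℕ+) : Multiset ℕ+) =
        ((2 : ℚ) • refineGen [n]) * etaGen (e : Multiset ℕ+) := by
      rw [etaGen, ← Multiset.cons_coe, Multiset.map_cons, Multiset.prod_cons]
      rfl
    rw [h, ih, refineGen_cons n e, List.length_cons, pow_succ', smul_mul_smul_comm]

/-- Multiplicativity in the shape is the dual form of the coproduct formula for the η_λ. -/
theorem etaGen_add (μ ν : IntPart) : etaGen (μ + ν) = etaGen μ * etaGen ν := by
  rw [etaGen, Multiset.map_add, Multiset.prod_add]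
  rfl

theorem etaGen_coeff_ne_zero {e : IntComp} {l : IntPart}
    (h : (etaGen ((e : Multiset ℕ+) : IntPart)).coeff l ≠ 0) :
    ∃ α : IntComp, ((α : Multiset ℕ+) : IntPart) = l ∧ IntComp.Refines e α := by
  classical
  rw [etaGen_coe, AddMonoidAlgebra.coeff_smul, Finsupp.smul_apply, coeff_refineGen] at h
  obtain ⟨α, hα, h0⟩ := Finset.exists_ne_zero_of_sum_ne_zero (right_ne_zero_of_smul h)
  rw [mem_lists_toFinset] at hα
  refine ⟨α, hα, ?_⟩
  by_contra hne
  exact h0 (if_neg hne)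

theorem exists_composition (a : ℕ →₀ ℕ) :
    ∃ e : IntComp, exponents a = e.map (fun n : ℕ+ => (n : ℕ)) := by
  refine ⟨(exponents a).map Nat.toPNat', ?_⟩
  rw [List.map_map]
  conv_lhs => rw [← List.map_id (exponents a)]
  refine List.map_congr_left fun x hx => ?_
  obtain ⟨i, hi, rfl⟩ := List.mem_map.1 hx
  rw [Finset.mem_sort, Finsupp.mem_support_iff] at hi
  simp [Nat.pos_of_ne_zero hi]

/-- Let e be the composition of nonzero exponents of x^a. Then M_e occurs in η_α exactly when α
refines e, with coefficient 2^k(e), so the coefficient counts the rearrangements of the partition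
that refine e. -/
theorem coeff_etaPart {a : ℕ →₀ ℕ} {μ : IntPart} (h : shape a = μ.parts) (l : IntPart) :
    MvPowerSeries.coeff a (etaPart l) = (etaGen μ).coeff l := by
  classical
  obtain ⟨e, he⟩ := exists_composition a
  have hμ : μ = ((e : Multiset ℕ+) : IntPart) := by
    apply IntPart.parts_injective
    rw [← h, shape_eq, he]
    rfl
  have hinj : ∀ γ : IntComp, exponents a = γ.map (fun n : ℕ+ => (n : ℕ)) ↔ e = γ := by
    intro γ
    rw [he]
    exact (List.map_injective_iff.2 PNat.coe_injective).eq_iff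
  rw [hμ, etaGen_coe, AddMonoidAlgebra.coeff_smul, Finsupp.smul_apply, coeff_refineGen, etaPart,
    map_sum, Finset.smul_sum]
  refine Finset.sum_congr rfl fun α _ => ?_
  have h1 : ∀ γ : IntComp, MvPowerSeries.coeff a (monoQSym γ) = if e = γ then 1 else 0 :=
    fun γ => if_congr (hinj γ) rfl rfl
  rw [etaComp, map_sum]
  simp only [map_smul, h1, smul_eq_mul, mul_ite, mul_one, mul_zero, Finset.sum_ite_eq,
    IntComp.mem_coarsenings]

theorem etaGen_coeff_eq_zero {μ l : IntPart} (h : μ.parts.sum ≠ l.parts.sum) :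
    (etaGen μ).coeff l = 0 := by
  by_contra h0
  induction μ using Quotient.inductionOn with
  | h e =>
  obtain ⟨α, rfl, hα⟩ := etaGen_coeff_ne_zero h0
  exact h hα.size_eq.symm

theorem isSymmetricSeries_etaPart (l : IntPart) : IsSymmetricSeries (etaPart l) := by
  refine ⟨⟨l.parts.sum, fun a ha => ?_⟩, fun a b hab => ?_⟩
  · obtain ⟨μ, hμ⟩ := exists_part a
    rw [coeff_etaPart hμ.symm, etaGen_coeff_eq_zero]
    rw [hμ, sum_shape]
    exact ha.ne'
  · obtain ⟨μ, hμ⟩ := exists_part a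
    rw [coeff_etaPart hμ.symm, coeff_etaPart (hab.symm.trans hμ.symm)]

/-- `η_λ` as a symmetric function. -/
def etaSym (l : IntPart) : Sym := ⟨etaPart l, (mem_Sym_iff _).2 (isSymmetricSeries_etaPart l)⟩

theorem symCoeff_etaSym {a : ℕ →₀ ℕ} {μ : IntPart} (h : shape a = μ.parts) (l : IntPart) :
    symCoeff a (etaSym l) = (etaGen μ).coeff l :=
  coeff_etaPart h l

theorem coord_etaSym (μ l : IntPart) : monoBasis.coord μ (etaSym l) = (etaGen μ).coeff l := by
  obtain ⟨a, ha⟩ := exists_shape μ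
  rw [monoBasis_coord ha, symCoeff_etaSym ha]

theorem etaSym_mem (l : IntPart) : etaSym l ∈ symGrading l.parts.sum := by
  intro a ha
  obtain ⟨μ, hμ⟩ := exists_part a
  rw [symCoeff_etaSym hμ.symm, etaGen_coeff_eq_zero]
  rwa [hμ, sum_shape]

theorem etaSym_zero : etaSym 0 = 1 := by
  refine monoBasis.ext_elem fun μ => ?_
  have h1 : monoBasis.repr (etaSym 0) μ = (etaGen μ).coeff 0 := coord_etaSym μ 0
  rw [h1, ← monoSym_zero, ← monoBasis_apply, Module.Basis.repr_self]
  by_cases hμ : μ = 0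
  · subst hμ
    simp [etaGen, AddMonoidAlgebra.one_def]
  · rw [Finsupp.single_eq_of_ne hμ]
    by_contra h0
    induction μ using Quotient.inductionOn with
    | h e =>
    obtain ⟨α, hα, h⟩ := etaGen_coeff_ne_zero h0
    rw [(Multiset.coe_eq_zero α).1 hα] at h
    have : e.length = 0 := Nat.le_zero.1 h.length_le.1
    exact hμ (by rw [List.length_eq_zero_iff.1 this]; rfl)

/-! ### Coproduct and character on the η_λ -/

theorem tensor_repr (s t : IntPart) (x : Sym ⊗[ℚ] Sym) :
    (monoBasis.tensorProduct monoBasis).repr x (s, t) =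
      tensorFunctional (monoBasis.coord s) (monoBasis.coord t) x := by
  have h : (monoBasis.tensorProduct monoBasis).coord (s, t) =
      tensorFunctional (monoBasis.coord s) (monoBasis.coord t) := by
    refine TensorProduct.ext' fun x y => ?_
    rw [tensorFunctional_tmul]
    simp [Module.Basis.tensorProduct_repr_tmul_apply, mul_comm]
  exact LinearMap.congr_fun h x

/-- The coordinate of Δ(f) at m_s ⊗ m_t is that of f at m_(s ⊔ t). For η_l it is a coefficient of a
product of two generating functions, which expands over the splittings of l. -/
theorem comul_etaSym (l : IntPart) : Coalgebra.comul (R := ℚ) (etaSym l) =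
    ∑ p ∈ l.splittings, etaSym p.1 ⊗ₜ[ℚ] etaSym p.2 := by
  refine (monoBasis.tensorProduct monoBasis).ext_elem ?_
  rintro ⟨s, t⟩
  rw [tensor_repr, tensor_repr, map_sum]
  have h1 : tensorFunctional (monoBasis.coord s) (monoBasis.coord t)
      (Coalgebra.comul (R := ℚ) (etaSym l)) = monoBasis.coord (s + t) (etaSym l) := by
    have := LinearMap.congr_fun (convFunctional_monoBasis_coord s t) (etaSym l)
    rwa [one_smul] at this
  rw [h1, coord_etaSym, etaGen_add,
    AddMonoidAlgebra.coeff_mul_antidiag _ _ _ _ IntPart.mem_splittings]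
  simp only [tensorFunctional_tmul, coord_etaSym]

/-- The coefficient of x₀^n belongs to the composition (n), which every rearrangement of l refines;
its weight is 2^1. The empty partition is exceptional, with weight 2^0. -/
theorem zetaS_etaSym (l : IntPart) : zetaS (etaSym l) =
    (if Multiset.card l = 0 then 1 else 2) * (l.lists.toFinset.card : ℚ) := by
  classical
  rw [zetaS_of_mem (etaSym_mem l)]
  rcases Nat.eq_zero_or_pos l.parts.sum with h0 | hpos
  · have hl : l = 0 := by
      by_contra hne
      obtain ⟨n, hn⟩ := Multiset.exists_mem_of_ne_zero hne
      have := Multiset.single_le_sum (fun _ _ => Nat.zero_le _) _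
        (Multiset.mem_map_of_mem (fun n : ℕ+ => (n : ℕ)) hn)
      have h1 : (n : ℕ) ≤ l.parts.sum := this
      have := n.pos
      omega
    subst hl
    rw [h0, Finsupp.single_zero, symCoeff_etaSym (μ := 0) (by simp [shape, IntPart.parts])]
    have h1 : (0 : Multiset ℕ+).lists.toFinset = {[]} := by
      ext α
      rw [mem_lists_toFinset, Finset.mem_singleton]
      exact Multiset.coe_eq_zero α
    rw [h1]
    simp [etaGen, AddMonoidAlgebra.one_def]
  · set n : ℕ+ := ⟨l.parts.sum, hpos⟩ with hn
    have hl : Multiset.card l ≠ 0 := by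
      intro h
      rw [Multiset.card_eq_zero.1 h] at hpos
      exact lt_irrefl _ hpos
    have hs : shape (Finsupp.single 0 l.parts.sum) = IntPart.parts {n} := by
      rw [shape_single _ _ hpos.ne']
      exact (Multiset.map_singleton _ _).symm
    rw [symCoeff_etaSym hs, if_neg hl, etaGen, Multiset.map_singleton, Multiset.prod_singleton,
      AddMonoidAlgebra.coeff_smul, Finsupp.smul_apply, coeff_refineGen, smul_eq_mul,
      Finset.sum_congr rfl (g := fun _ => (1 : ℚ)), Finset.sum_const, nsmul_eq_mul, mul_one]
    intro α hα
    rw [mem_lists_toFinset] at hα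
    refine if_pos ((IntComp.refines_singleton _ _).2 ?_)
    rw [show (n : ℕ) = l.parts.sum from rfl, ← hα]
    rfl

/-- Cutting an arrangement of `l` into an arrangement of `μ` and one of `ν`, with `μ ⊔ ν = l`. -/
theorem sum_splittings_lists (l : IntPart) (f g : ℕ → ℚ) :
    (∑ p ∈ l.splittings, (f (Multiset.card p.1) * (p.1.lists.toFinset.card : ℚ)) *
      (g (Multiset.card p.2) * (p.2.lists.toFinset.card : ℚ))) =
      (∑ j ∈ Finset.range (Multiset.card l + 1), f j * g (Multiset.card l - j)) *
        (l.lists.toFinset.card : ℚ) := by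
  have h1 : ∀ p ∈ l.splittings, (f (Multiset.card p.1) * (p.1.lists.toFinset.card : ℚ)) *
      (g (Multiset.card p.2) * (p.2.lists.toFinset.card : ℚ)) =
        ∑ _x ∈ p.1.lists.toFinset ×ˢ p.2.lists.toFinset,
          f (Multiset.card p.1) * g (Multiset.card p.2) := by
    intro p _
    rw [Finset.sum_const, Finset.card_product, nsmul_eq_mul]
    push_cast
    ring
  have h2 : ∀ j ∈ Finset.range (Multiset.card l + 1), f j * g (Multiset.card l - j) *
      (l.lists.toFinset.card : ℚ) = ∑ _α ∈ l.lists.toFinset, f j * g (Multiset.card l - j) := by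
    intro j _
    rw [Finset.sum_const, nsmul_eq_mul, mul_comm]
  rw [Finset.sum_congr rfl h1, Finset.sum_mul, Finset.sum_congr rfl h2, Finset.sum_sigma',
    Finset.sum_sigma']
  -- A pair of arrangements (α, β) corresponds to the arrangement αβ of l together with the cut
  -- position, the length of α.
  refine Finset.sum_bij' (fun x _ => ⟨x.2.1.length, x.2.1 ++ x.2.2⟩)
    (fun x _ => ⟨((x.2.take x.1 : List ℕ+), (x.2.drop x.1 : List ℕ+)),
      (x.2.take x.1, x.2.drop x.1)⟩) ?_ ?_ ?_ ?_ ?_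
  · rintro ⟨⟨μ, ν⟩, ⟨α, β⟩⟩ h
    simp only [Finset.mem_sigma, IntPart.mem_splittings, Finset.mem_product, mem_lists_toFinset, Finset.mem_range] at h ⊢
    obtain ⟨rfl, rfl, rfl⟩ := h
    refine ⟨?_, rfl⟩
    rw [Multiset.card_add, Multiset.coe_card, Multiset.coe_card]
    omega
  · rintro ⟨j, α⟩ h
    simp only [Finset.mem_sigma, IntPart.mem_splittings, Finset.mem_product, mem_lists_toFinset, Finset.mem_range] at h ⊢
    obtain ⟨-, rfl⟩ := h
    refine ⟨?_, trivial, trivial⟩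
    rw [Multiset.coe_add, List.take_append_drop]
  · rintro ⟨⟨μ, ν⟩, ⟨α, β⟩⟩ h
    simp only [Finset.mem_sigma, IntPart.mem_splittings, Finset.mem_product, mem_lists_toFinset] at h
    obtain ⟨-, rfl, rfl⟩ := h
    simp
  · rintro ⟨j, α⟩ h
    simp only [Finset.mem_sigma, mem_lists_toFinset,
      Finset.mem_range] at h
    obtain ⟨h, rfl⟩ := h
    rw [Multiset.coe_card] at h
    simp only [List.take_append_drop, List.length_take]
    rw [min_eq_left (by omega)]
  · rintro ⟨⟨μ, ν⟩, ⟨α, β⟩⟩ h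
    simp only [Finset.mem_sigma, IntPart.mem_splittings, Finset.mem_product, mem_lists_toFinset] at h
    obtain ⟨rfl, rfl, rfl⟩ := h
    simp

/-- This is the coefficient of t^k in (1 + t)/(1 - t) · (1 - t)/(1 + t) = 1. Here the two end terms
are split off and the inner ones are summed as a geometric progression of ratio -1. -/
theorem sum_alternating {k : ℕ} (hk : k ≠ 0) : (∑ j ∈ Finset.range (k + 1),
    (if j = 0 then 1 else 2 : ℚ) * ((-1) ^ (k - j) * (if k - j = 0 then 1 else 2 : ℚ))) = 0 := by
  obtain ⟨m, rfl⟩ := Nat.exists_eq_succ_of_ne_zero hk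
  rw [Finset.sum_range_succ, Finset.sum_range_succ']
  have h : ∀ j ∈ Finset.range m, (if j + 1 = 0 then 1 else 2 : ℚ) *
      ((-1) ^ (m.succ - (j + 1)) * (if m.succ - (j + 1) = 0 then 1 else 2 : ℚ)) =
        (-4) * (-1) ^ (m - 1 - j) := by
    intro j hj
    rw [Finset.mem_range] at hj
    have e : m.succ - (j + 1) = m - 1 - j + 1 := by omega
    rw [if_neg (by omega), e, if_neg (by omega), pow_succ]
    ring
  rw [Finset.sum_congr rfl h, ← Finset.mul_sum,
    Finset.sum_range_reflect (fun i => (-1 : ℚ) ^ i) m, neg_one_geom_sum]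
  rcases Nat.even_or_odd m with hm | hm
  · simp [hm, pow_succ]
  · have : ¬ Even m := Nat.not_even_iff_odd.2 hm
    simp [this, pow_succ, hm.neg_one_pow]
    norm_num

/-- For odd partitions the sign in ζ̄ depends only on the number of parts, as `sum_splittings_lists`
requires. -/
theorem IntPart.IsOdd.neg_one_pow {l : IntPart} (hl : l.IsOdd) :
    (-1 : ℚ) ^ l.parts.sum = (-1) ^ Multiset.card l := by
  induction l using Multiset.induction_on with
  | empty => rfl
  | cons n l ih =>
    rw [parts_cons, Multiset.sum_cons, pow_add, ih fun m hm => hl m (Multiset.mem_cons_of_mem hm),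
      (hl n (Multiset.mem_cons_self _ _)).neg_one_pow, Multiset.card_cons, pow_succ']

/-- Each splitting of l contributes the numbers of arrangements of its two pieces, with weights
depending on the numbers of parts alone. Regrouped by arrangements of l, the sum factors through the
alternating sum, which is 0 for nonempty l. -/
theorem zetaConvBar_etaSym {l : IntPart} (hl : l.IsOdd) :
    zetaConvBar (etaSym l) = Coalgebra.counit (R := ℚ) (etaSym l) := by
  by_cases h0 : Multiset.card l = 0
  · rw [Multiset.card_eq_zero.1 h0]
    rw [etaSym_zero, ← powerSumPart_zero, zetaConvBar_powerSumPart, powerSumPart_zero,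
      Bialgebra.counit_one]
    simp
  · have hs : l.parts.sum ≠ 0 := by
      intro h
      rw [Multiset.sum_eq_zero_iff] at h
      obtain ⟨n, hn⟩ := Multiset.exists_mem_of_ne_zero (fun h => h0 (Multiset.card_eq_zero.2 h))
      exact n.ne_zero (h n (Multiset.mem_map_of_mem _ hn))
    rw [counit_of_mem hs (etaSym_mem l), zetaConvBar, convFunctional, LinearMap.comp_apply,
      comul_etaSym, map_sum]
    have h : ∀ p ∈ l.splittings, tensorFunctional zetaS.toLinearMap
        (barFunctional symGrading zetaS.toLinearMap) (etaSym p.1 ⊗ₜ[ℚ] etaSym p.2) =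
        ((if Multiset.card p.1 = 0 then 1 else 2 : ℚ) * (p.1.lists.toFinset.card : ℚ)) *
        (((-1) ^ Multiset.card p.2 * (if Multiset.card p.2 = 0 then 1 else 2 : ℚ)) *
          (p.2.lists.toFinset.card : ℚ)) := by
      intro p hp
      rw [IntPart.mem_splittings] at hp
      have hodd : IntPart.IsOdd p.2 := fun n hn => hl n (by
        rw [← hp]; exact Multiset.mem_add.2 (Or.inr hn))
      rw [tensorFunctional_tmul, barFunctional_of_mem _ _ (etaSym_mem p.2),
        AlgHom.toLinearMap_apply, AlgHom.toLinearMap_apply, zetaS_etaSym, zetaS_etaSym,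
        hodd.neg_one_pow, mul_assoc ((-1 : ℚ) ^ _)]
    rw [Finset.sum_congr rfl h, sum_splittings_lists l (fun j => if j = 0 then 1 else 2)
      (fun j => (-1) ^ j * if j = 0 then 1 else 2), sum_alternating h0, zero_mul]

theorem etaSym_mem_oddSubalgebra {l : IntPart} (hl : l.IsOdd) :
    etaSym l ∈ oddSubalgebra symGrading zetaS := by
  refine le_oddSubalgebra (s := etaSym '' {l | l.IsOdd}) ?_ ?_ (Submodule.subset_span ⟨l, hl, rfl⟩)
  · refine isGradedSubcoalgebra_span symGrading ?_ ?_
    · rintro _ ⟨l, -, rfl⟩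
      exact ⟨_, etaSym_mem l⟩
    · rintro _ ⟨l, hl, rfl⟩
      rw [comul_etaSym]
      refine Submodule.sum_mem _ fun p hp => ?_
      rw [IntPart.mem_splittings] at hp
      refine tmul_mem_range (Submodule.subset_span ⟨p.1, fun n hn => hl n ?_, rfl⟩)
        (Submodule.subset_span ⟨p.2, fun n hn => hl n ?_, rfl⟩)
      · rw [← hp]; exact Multiset.mem_add.2 (Or.inl hn)
      · rw [← hp]; exact Multiset.mem_add.2 (Or.inr hn)
  · rintro _ ⟨l, hl, rfl⟩
    exact zetaConvBar_etaSym hl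

/-- The function m_l occurs in η_μ only if some arrangement of μ refines one of l, so l has fewer
parts than μ or equals it; on the diagonal the coefficient is positive. -/
theorem linearIndependent_etaSym (T : Set IntPart) : LinearIndependent ℚ fun l : T => etaSym l := by
  classical
  refine linearIndependent_of_triangular (fun l _ μ _ hne hc => ?_) fun l _ => ?_
  · rw [coord_etaSym]
    by_contra h0
    induction l using Quotient.inductionOn with
    | h e =>
    obtain ⟨α, rfl, hα⟩ := etaGen_coeff_ne_zero h0
    obtain ⟨h1, h2⟩ := hα.length_le
    have hc' : α.length ≤ e.length := hc
    exact hne (by rw [h2 (le_antisymm h1 hc')]; rfl)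
  · rw [coord_etaSym]
    induction l using Quotient.inductionOn with
    | h e =>
    have h1 : (etaGen ((e : Multiset ℕ+) : IntPart)).coeff ((e : Multiset ℕ+) : IntPart) ≠ 0 := by
      rw [etaGen_coe, AddMonoidAlgebra.coeff_smul, Finsupp.smul_apply, coeff_refineGen]
      refine smul_ne_zero (by positivity) (ne_of_gt (Finset.sum_pos' (fun α _ => ?_) ⟨e, ?_, ?_⟩))
      · split_ifs <;> norm_num
      · exact mem_lists_toFinset.2 rfl
      · rw [if_pos (IntComp.refines_self e)]
        norm_num
    exact h1

/-- The inclusion is membership in the odd subalgebra, already known to be spanned by the odd p_λ.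
No expansion of p_λ in the η_μ is needed, because the dimension count gives equality. -/
theorem span_etaSym_odd : Submodule.span ℚ (etaSym '' {l | l.IsOdd}) =
    Submodule.span ℚ (powerSumPart '' {l | l.IsOdd}) := by
  refine span_eq_of_linearIndependent (linearIndependent_etaSym _) fun l hl => ?_
  have h := etaSym_mem_oddSubalgebra hl
  rw [oddSubalgebra_eq, ← coe_powerBasis, mem_span_image_iff_coord] at h
  rw [← coe_powerBasis, mem_span_image_iff_coord]
  intro μ hμ
  by_cases hd : μ.parts.sum = l.parts.sum
  · exact h μ fun hodd => hμ ⟨hodd, hd⟩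
  · exact powerBasis_coord_eq_zero_of_mem (etaSym_mem l) hd

/-! ### From equal spans to bases -/

theorem linearIndependent_monoSym (T : Set IntPart) :
    LinearIndependent ℚ fun l : T => monoSym l := by
  rw [← coe_monoBasis]
  exact monoBasis.linearIndependent.comp _ Subtype.val_injective

theorem exists_basis_of_span_eq {P : IntPart → Prop} {v : IntPart → Sym} {S : Submodule ℚ Sym}
    (hv : LinearIndependent ℚ fun l : {l // P l} => v l)
    (hS : S = Submodule.span ℚ (v '' {l | P l})) :
    ∃ b : Module.Basis {l // P l} ℚ S, ∀ l, (b l : Sym) = v l.1 := by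
  rw [Set.image_eq_range] at hS
  subst hS
  exact ⟨Module.Basis.span hv, fun l => congrArg Subtype.val (Module.Basis.span_apply hv l)⟩

end CombHopf

end

/-- The even and odd subalgebras of `(Sym, ζ_S)` over `ℚ`. -/
theorem propositionP :
    -- the `p_λ`, `λ` odd, are a basis of the odd subalgebra
    (∃ b : Module.Basis {l : CombHopf.IntPart // l.IsOdd} ℚ (CombHopf.oddSubalgebra CombHopf.symGrading CombHopf.zetaS),
      ∀ l, (b l : CombHopf.Sym) = CombHopf.powerSumPart l.1) ∧
    -- the `η_λ`, `λ` odd, are a basis of the odd subalgebra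
    (∃ b : Module.Basis {l : CombHopf.IntPart // l.IsOdd} ℚ (CombHopf.oddSubalgebra CombHopf.symGrading CombHopf.zetaS),
      ∀ l, ((b l : CombHopf.Sym) : MvPowerSeries ℕ ℚ) = CombHopf.etaPart l.1) ∧
    -- the odd subalgebra is the algebra of Schur `Q`-functions
    CombHopf.oddSubalgebra CombHopf.symGrading CombHopf.zetaS = Subalgebra.toSubmodule CombHopf.schurQAlgebra ∧
    -- the `p_λ`, `λ` even, are a basis of the even subalgebra
    (∃ b : Module.Basis {l : CombHopf.IntPart // l.IsEven} ℚ (CombHopf.evenSubalgebra CombHopf.symGrading CombHopf.zetaS),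
      ∀ l, (b l : CombHopf.Sym) = CombHopf.powerSumPart l.1) ∧
    -- the `m_λ`, `λ` even, are a basis of the even subalgebra
    (∃ b : Module.Basis {l : CombHopf.IntPart // l.IsEven} ℚ (CombHopf.evenSubalgebra CombHopf.symGrading CombHopf.zetaS),
      ∀ l, (b l : CombHopf.Sym) = CombHopf.monoSym l.1) := by
  refine ⟨?_, ?_, ?_, ?_, ?_⟩
  · exact CombHopf.exists_basis_of_span_eq (CombHopf.linearIndependent_powerSumPart _)
      CombHopf.oddSubalgebra_eq
  · obtain ⟨b, hb⟩ := CombHopf.exists_basis_of_span_eq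
      (CombHopf.linearIndependent_etaSym {l | l.IsOdd})
      (CombHopf.oddSubalgebra_eq.trans CombHopf.span_etaSym_odd.symm)
    exact ⟨b, fun l => congrArg Subtype.val (hb l)⟩
  · rw [CombHopf.oddSubalgebra_eq, CombHopf.span_powerSumPart_odd]
  · exact CombHopf.exists_basis_of_span_eq (CombHopf.linearIndependent_powerSumPart _)
      (CombHopf.evenSubalgebra_eq.trans CombHopf.span_powerSumPart_even.symm)
  · exact CombHopf.exists_basis_of_span_eq
      (CombHopf.linearIndependent_monoSym {l | l.IsEven}) CombHopf.evenSubalgebra_eq
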